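/- Let $A\in\mathrm{GL}_4(\mathbb Z)$ be hyperbolic, i.e. all its eigenvalues are real and its characteristic polynomial is irreducible over $\mathbb Q$, and let $l_1,l_2,l_3,l_4\subset\mathbb R^4$ be its four one-dimensional eigenspaces. Let $\mathcal C$ be the set of the $2^4$ simplicial cones with apex $0$ into which the hyperplanes spanned by the triples of these lines divide $\mathbb R^4$; for $C\in\mathcal C$ the sail of $C$ is the boundary of the convex hull of $C\cap\mathbb Z^4\setminus\{0\}$, and the three-dimensional algebraic continued fraction $\mathrm{CF}(l_1,l_2,l_3,l_4)$ is the union of the $2^4$ sails. A symmetry of it is an operator $G\in\mathrm{GL}_4(\mathbb Z)$ with $G(\mathrm{CF}(l_1,l_2,l_3,l_4))=\mathrm{CF}(l_1,l_2,l_3,l_4)$; it determines a permutation $\sigma_G$ with $G(l_i)=l_{\sigma_G(i)}$ for all $i$. A symmetry $G$ is proper if $\sigma_G\ne\mathrm{id}$ and $G$ has a fixed point on some sail, and cyclic if $\sigma_G$ is a $4$-cycle. For $v,w\in\mathbb R^4$ write $v\sim w$ if there are $X\in\mathrm{GL}_4(\mathbb Z)$ and a nonzero $\mu\in\mathbb R$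 with $Xv=\mu w$. **Theorem 4.** Let $l_1$ be spanned by $(1,\alpha,\beta,\gamma)$ and let $K=\mathbb Q(\alpha,\beta,\gamma)$. Then $\mathrm{CF}(l_1,l_2,l_3,l_4)$ has a proper cyclic symmetry (a symmetry that is both proper and cyclic) if and only if $K$ is a cyclic Galois extension of $\mathbb Q$ of degree $4$ and there are a generator $\sigma$ of its Galois group and an algebraic number $\omega\in K$ of degree $4$ such that, with $\psi=\sigma(\omega)$, $\omega'=\sigma^2(\omega)$ and $\psi'=\sigma^2(\psi)=\sigma^3(\omega)$, at least one of the following holds: 1. $(1,\alpha,\beta,\gamma)\sim(1,\omega,\psi,\omega')$ and $\psi+\psi'=-(\omega+\omega')$; 2. $(1,\alpha,\beta,\gamma)\sim(1,\omega,\psi,\omega')$ and $\psi+\psi'=1-(\omega+\omega')$; 3. $(1,\alpha,\beta,\gamma)\sim(1,\omega,\psi,\omega')$ and $\psi+\psi'=2-(\omega+\omega')$; 4. $(1,\alpha,\beta,\gamma)\sim(1,\omega,\psi,\frac{\omega+\omega'}{2})$ and $\psi+\psi'=-(\omega+\omega')$; 5. $(1,\alpha,\beta,\gamma)\sim(1,\omega,\psi,\frac{\omega+\omega'}{2})$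 and $\psi+\psi'=2-(\omega+\omega')$; 6. $(1,\alpha,\beta,\gamma)\sim(1,\omega,\psi,\frac{\omega+\omega'+1}{2})$ and $\psi+\psi'=-(\omega+\omega')$; 7. $(1,\alpha,\beta,\gamma)\sim(1,\omega,\psi,\frac{\omega+\omega'+1}{2})$ and $\psi+\psi'=2-(\omega+\omega')$. -/

import Mathlib

open scoped MatrixGroups

namespace KleinCF

/-- The linear operator on `ℝⁿ` given by an integer matrix from `GL_n(ℤ)`. -/
noncomputable def realOp {n : ℕ} (G : GL (Fin n) ℤ) : (Fin n → ℝ) →ₗ[ℝ] (Fin n → ℝ) :=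
  Matrix.toLin' ((G : Matrix (Fin n) (Fin n) ℤ).map (Int.castRingHom ℝ))

/-- The integer lattice `ℤⁿ` in `ℝⁿ`. -/
def integerPoints (n : ℕ) : Set (Fin n → ℝ) :=
  {x | ∃ z : Fin n → ℤ, ∀ i, x i = (z i : ℝ)}

/-- The set `𝒞(l₁, …, lₙ)` of (closed) simplicial cones into which the hyperplanes spanned by
`(n-1)`-subfamilies of the lines `l₁, …, lₙ` split `ℝⁿ`: each of them is generated by one nonzero
vector taken from each line. -/
def cones {n : ℕ} (l : Fin n → Submodule ℝ (Fin n → ℝ)) : Set (Set (Fin n → ℝ)) :=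
  {C | ∃ v : Fin n → (Fin n → ℝ), (∀ i, v i ∈ l i ∧ v i ≠ 0) ∧
    C = {x | ∃ t : Fin n → ℝ, (∀ i, 0 ≤ t i) ∧ x = ∑ i, t i • v i}}

/-- The Klein polyhedron of a cone. -/
def kleinPolyhedron {n : ℕ} (C : Set (Fin n → ℝ)) : Set (Fin n → ℝ) :=
  convexHull ℝ ((C ∩ integerPoints n) \ {0})

/-- The Klein sail of a cone. -/
def sail {n : ℕ} (C : Set (Fin n → ℝ)) : Set (Fin n → ℝ) :=
  frontier (kleinPolyhedron C)

/-- The `(n-1)`-dimensional geometric continued fraction `CF(l₁, …, lₙ)`: the union of the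
`2ⁿ` sails. -/
def CF {n : ℕ} (l : Fin n → Submodule ℝ (Fin n → ℝ)) : Set (Fin n → ℝ) :=
  ⋃ C ∈ cones l, sail C

/-- Hyperbolic operators: elements of `GL_n(ℤ)` with real eigenvalues whose characteristic
polynomial is irreducible over `ℚ`. -/
def IsHyperbolic {n : ℕ} (A : GL (Fin n) ℤ) : Prop :=
  Irreducible ((A : Matrix (Fin n) (Fin n) ℤ).map (Int.castRingHom ℚ)).charpoly ∧
  ((A : Matrix (Fin n) (Fin n) ℤ).map (Int.castRingHom ℝ)).charpoly.Splits

/-- `CF(l₁, …, lₙ)` is algebraic: `l₁, …, lₙ` are the `n` (distinct) eigenspaces of some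
hyperbolic operator. -/
def IsAlgebraic {n : ℕ} (l : Fin n → Submodule ℝ (Fin n → ℝ)) : Prop :=
  ∃ A : GL (Fin n) ℤ, IsHyperbolic A ∧ Function.Injective l ∧
    ∀ i, ∃ μ : ℝ, Module.End.HasEigenvalue (realOp A) μ ∧
      l i = Module.End.eigenspace (realOp A) μ

/-- `G` belongs to the symmetry group of `CF(l₁, …, lₙ)`. -/
def IsSymmetry {n : ℕ} (l : Fin n → Submodule ℝ (Fin n → ℝ)) (G : GL (Fin n) ℤ) : Prop :=
  realOp G '' CF l = CF l

/-- `G` maps the line `l i` onto the line `l (τ i)` for every `i`, i.e. `σ_G = τ`. -/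
def InducesPerm {n : ℕ} (l : Fin n → Submodule ℝ (Fin n → ℝ)) (G : GL (Fin n) ℤ)
    (τ : Equiv.Perm (Fin n)) : Prop :=
  ∀ i, (l i).map (realOp G) = l (τ i)

/-- A palindromic symmetry is a symmetry that is not a Dirichlet symmetry (`σ_G = id`). -/
def IsPalindromicSymmetry {n : ℕ} (l : Fin n → Submodule ℝ (Fin n → ℝ)) (G : GL (Fin n) ℤ) :
    Prop :=
  IsSymmetry l G ∧ ¬ InducesPerm l G 1

/-- A proper symmetry is a palindromic symmetry with a fixed point on some sail. -/
def IsProperSymmetry {n : ℕ} (l : Fin n → Submodule ℝ (Fin n → ℝ)) (G : GL (Fin n) ℤ) : Prop :=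
  IsPalindromicSymmetry l G ∧ ∃ C ∈ cones l, ∃ x ∈ sail C, realOp G x = x

/-- A cyclic symmetry is a symmetry `G` for which `σ_G` is a cyclic permutation of all the
lines. -/
def IsCyclicSymmetry {n : ℕ} (l : Fin n → Submodule ℝ (Fin n → ℝ)) (G : GL (Fin n) ℤ) : Prop :=
  IsSymmetry l G ∧
    ∃ τ : Equiv.Perm (Fin n), InducesPerm l G τ ∧ τ.IsCycle ∧ τ.support = Finset.univ

/-- `v ∼ w`: there are `X ∈ GL_n(ℤ)` and a nonzero real `μ` with `X v = μ w`. -/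
def Equivalent {n : ℕ} (v w : Fin n → ℝ) : Prop :=
  ∃ (X : GL (Fin n) ℤ) (μ : ℝ), μ ≠ 0 ∧ realOp X v = μ • w

/-- At least one of the seven conditions on the vector `v = (1, α, β, γ)` and the numbers
`ω, ψ, ω', ψ'`. -/
def SevenConditions (v : Fin 4 → ℝ) (ω ψ ω' ψ' : ℝ) : Prop :=
  (Equivalent v ![1, ω, ψ, ω'] ∧ ψ + ψ' = -(ω + ω')) ∨
  (Equivalent v ![1, ω, ψ, ω'] ∧ ψ + ψ' = 1 - (ω + ω')) ∨
  (Equivalent v ![1, ω, ψ, ω'] ∧ ψ + ψ' = 2 - (ω + ω')) ∨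
  (Equivalent v ![1, ω, ψ, (ω + ω') / 2] ∧ ψ + ψ' = -(ω + ω')) ∨
  (Equivalent v ![1, ω, ψ, (ω + ω') / 2] ∧ ψ + ψ' = 2 - (ω + ω')) ∨
  (Equivalent v ![1, ω, ψ, (ω + ω' + 1) / 2] ∧ ψ + ψ' = -(ω + ω')) ∨
  (Equivalent v ![1, ω, ψ, (ω + ω' + 1) / 2] ∧ ψ + ψ' = 2 - (ω + ω'))

end KleinCF

/-!
Write `v = (1, α, β, γ)` and `E = K`. As `v` is an eigenvector of an integer matrix with irreducible
characteristic polynomial, its coordinates form a `ℚ`-basis of `E`, and `E` is generated by the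
eigenvalue (`eigenvector_coordinates`), so it has degree `4`.

A cyclic symmetry `G` fixing a point of a sail fixes a nonzero vector, since sails avoid the origin
(`zero_notMem_sail`). Hence `G` also has an integer left eigenvector `q` with eigenvalue `1`.
Normalize `v` to `w = v / (q · v)`. The vector `G w` has entries in `E` and spans another eigenline,
whose eigenvalue therefore lies in `E` and is the image of the eigenvalue of `v` under an
automorphism `σ`. Both `G w` and the conjugate `σ w` span this line and are normalized by `q`, so
`σ w = G w`. Since `G` permutes the four lines cyclically, `σ` has order `4`, so `E` is Galois with
group generated by `σ` (`IsEigenframe.exists_galois_generator`).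

Consequently the lattice `M ⊂ E` spanned by the entries of `w` is stable under `σ` and
contains `1`. The filtration of `M` by the kernels of `σ - 1` and `σ² - 1` has as successive
quotients two infinite cyclic groups and a free `ℤ[i]`-module of rank one; generators are found by
the Euclidean algorithm with respect to the forms `x²` and `x² + σ(x)²`
(`exists_adapted_generators`). So `M = d (ℤ + ℤ e + ℤ f + ℤ σ f)` with `σ e + e ∈ ℤ` and
`σ² f + f ∈ ℤ + k e`. If `k` is odd, some `ω = ±(f - m e) + j` gives a basis `1, ω, σ ω, σ² ω`, with
trace reduced modulo `4` and up to sign to `0`, `1` or `2` (`span_eq_of_odd`). If `k` is even, some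
`ω = f - m e + j` satisfies `ω + σ² ω ∈ 2 e + ℤ`, with trace reduced to `0` or `2`
(`span_eq_of_even`). These are the seven conditions.

Conversely, in each of the seven cases `σ` acts on the entries of the given vector through an
integer matrix, which conjugated by the equivalence with `v` yields `G ∈ GL₄(ℤ)` permuting the
eigenlines as `σ` permutes the conjugates of `v`. It preserves the set of sails
(`InducesPerm.isSymmetry`), and it fixes a nonzero integer vector because it fixes an integer form.
The segment from the origin to this vector crosses a sail, at a fixed point of `G`
(`exists_smul_mem_sail`).
-/

namespace KleinCF

open Matrix

/-! ### Integer matrices acting on vectors -/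

/-- The action of an integer matrix on column vectors with entries in a commutative ring. -/
def intMulVec {n : ℕ} {R : Type*} [CommRing R] (G : Matrix (Fin n) (Fin n) ℤ) (u : Fin n → R) :
    Fin n → R :=
  G.map (Int.castRingHom R) *ᵥ u

section intMulVec

variable {n : ℕ} {R S : Type*} [CommRing R] [CommRing S]

lemma intMulVec_apply (G : Matrix (Fin n) (Fin n) ℤ) (u : Fin n → R) (i : Fin n) :
    intMulVec G u i = ∑ j, (G i j : R) * u j := by
  simp [intMulVec, mulVec, dotProduct]

lemma intMulVec_mul (G H : Matrix (Fin n) (Fin n) ℤ) (u : Fin n → R) :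
    intMulVec (G * H) u = intMulVec G (intMulVec H u) := by
  rw [intMulVec, Matrix.map_mul, intMulVec, intMulVec, mulVec_mulVec]

@[simp] lemma intMulVec_one (u : Fin n → R) : intMulVec 1 u = u := by
  simp [intMulVec]

lemma intMulVec_smul (G : Matrix (Fin n) (Fin n) ℤ) (c : R) (u : Fin n → R) :
    intMulVec G (c • u) = c • intMulVec G u := by
  simp [intMulVec, mulVec_smul]

lemma intMulVec_map (f : R →+* S) (G : Matrix (Fin n) (Fin n) ℤ) (u : Fin n → R) (i : Fin n) :
    f (intMulVec G u i) = intMulVec G (fun j => f (u j)) i := by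
  simp [intMulVec_apply]

lemma realOp_apply (G : GL (Fin n) ℤ) (u : Fin n → ℝ) :
    realOp G u = intMulVec (G : Matrix (Fin n) (Fin n) ℤ) u := by
  simp [realOp, intMulVec]

@[simp] lemma intMulVec_inv_apply_self (G : GL (Fin n) ℤ) (u : Fin n → R) :
    intMulVec (↑G⁻¹ : Matrix (Fin n) (Fin n) ℤ)
      (intMulVec (G : Matrix (Fin n) (Fin n) ℤ) u) = u := by
  rw [← intMulVec_mul, ← Units.val_mul]; simp

lemma realOp_inv_apply_self (G : GL (Fin n) ℤ) (u : Fin n → ℝ) :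
    realOp G⁻¹ (realOp G u) = u := by
  rw [realOp_apply, realOp_apply, intMulVec_inv_apply_self]

lemma realOp_apply_inv_self (G : GL (Fin n) ℤ) (u : Fin n → ℝ) :
    realOp G (realOp G⁻¹ u) = u := by
  simpa using realOp_inv_apply_self G⁻¹ u

end intMulVec

/-! ### Sails and operators permuting the lines -/

section sails

variable {n : ℕ} {l : Fin n → Submodule ℝ (Fin n → ℝ)}

/-- The homeomorphism of `ℝⁿ` given by `realOp G`. -/
noncomputable def realOpHomeomorph (G : GL (Fin n) ℤ) : (Fin n → ℝ) ≃ₜ (Fin n → ℝ) where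
  toFun := realOp G
  invFun := realOp G⁻¹
  left_inv := realOp_inv_apply_self G
  right_inv := realOp_apply_inv_self G
  continuous_toFun := (realOp G).continuous_of_finiteDimensional
  continuous_invFun := (realOp G⁻¹).continuous_of_finiteDimensional

lemma realOp_injective (G : GL (Fin n) ℤ) : Function.Injective (realOp G) :=
  (realOpHomeomorph G).injective

lemma realOp_mem_integerPoints (G : GL (Fin n) ℤ) {x : Fin n → ℝ} (hx : x ∈ integerPoints n) :
    realOp G x ∈ integerPoints n := by
  obtain ⟨z, hz⟩ := hx
  refine ⟨(G : Matrix (Fin n) (Fin n) ℤ) *ᵥ z, fun i => ?_⟩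
  rw [realOp_apply, intMulVec_apply]
  simp [hz, mulVec, dotProduct]

lemma image_realOp_integerPoints (G : GL (Fin n) ℤ) :
    realOp G '' integerPoints n = integerPoints n := by
  refine Set.Subset.antisymm ?_ fun x hx => ?_
  · rintro _ ⟨x, hx, rfl⟩
    exact realOp_mem_integerPoints G hx
  · exact ⟨realOp G⁻¹ x, realOp_mem_integerPoints _ hx, realOp_apply_inv_self G x⟩

lemma image_realOp_sail (G : GL (Fin n) ℤ) (C : Set (Fin n → ℝ)) :
    realOp G '' sail C = sail (realOp G '' C) := by
  have hinj := realOp_injective G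
  have h := (realOpHomeomorph G).image_frontier (kleinPolyhedron C)
  change realOp G '' frontier _ = frontier (realOp G '' _) at h
  rw [sail, h, sail, kleinPolyhedron, kleinPolyhedron, LinearMap.image_convexHull,
    Set.image_sdiff hinj, Set.image_inter hinj, image_realOp_integerPoints, Set.image_singleton,
    map_zero]

lemma InducesPerm.inv {G : GL (Fin n) ℤ} {τ : Equiv.Perm (Fin n)} (h : InducesPerm l G τ) :
    InducesPerm l G⁻¹ τ⁻¹ := by
  intro i
  have := h (τ⁻¹ i)
  rw [show τ (τ⁻¹ i) = i from τ.apply_symm_apply i] at this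
  rw [← this, ← Submodule.map_comp]
  have hid : realOp G⁻¹ ∘ₗ realOp G = LinearMap.id := LinearMap.ext (realOp_inv_apply_self G)
  rw [hid, Submodule.map_id]

lemma image_realOp_mem_cones {G : GL (Fin n) ℤ} {τ : Equiv.Perm (Fin n)}
    (h : InducesPerm l G τ) {C : Set (Fin n → ℝ)} (hC : C ∈ cones l) :
    realOp G '' C ∈ cones l := by
  obtain ⟨v, hv, rfl⟩ := hC
  refine ⟨fun i => realOp G (v (τ⁻¹ i)), fun i => ⟨?_, ?_⟩, ?_⟩
  · have := h (τ⁻¹ i)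
    rw [show τ (τ⁻¹ i) = i from τ.apply_symm_apply i] at this
    rw [← this]
    exact Submodule.mem_map_of_mem (hv _).1
  · exact fun h0 => (hv (τ⁻¹ i)).2 (realOp_injective G (h0.trans (map_zero _).symm))
  · ext y
    constructor
    · rintro ⟨_, ⟨t, ht, rfl⟩, rfl⟩
      refine ⟨fun i => t (τ⁻¹ i), fun i => ht _, ?_⟩
      simp only [map_sum, map_smul]
      exact (Equiv.sum_comp τ⁻¹ fun i => t i • realOp G (v i)).symm
    · rintro ⟨t, ht, rfl⟩
      refine ⟨_, ⟨fun i => t (τ i), fun i => ht _, rfl⟩, ?_⟩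
      simp only [map_sum, map_smul]
      rw [← Equiv.sum_comp τ⁻¹]
      simp

lemma image_realOp_CF_subset {G : GL (Fin n) ℤ} {τ : Equiv.Perm (Fin n)}
    (h : InducesPerm l G τ) : realOp G '' CF l ⊆ CF l := by
  rintro _ ⟨x, hx, rfl⟩
  simp only [CF, Set.mem_iUnion] at hx ⊢
  obtain ⟨C, hC, hxC⟩ := hx
  exact ⟨_, image_realOp_mem_cones h hC, by
    rw [← image_realOp_sail]; exact Set.mem_image_of_mem _ hxC⟩

/-- An operator permuting the lines permutes the cones and preserves `ℤⁿ`, hence it permutes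
the sails. -/
lemma InducesPerm.isSymmetry {G : GL (Fin n) ℤ} {τ : Equiv.Perm (Fin n)}
    (h : InducesPerm l G τ) : IsSymmetry l G := by
  refine (image_realOp_CF_subset h).antisymm fun x hx => ?_
  exact ⟨realOp G⁻¹ x, image_realOp_CF_subset h.inv (Set.mem_image_of_mem _ hx),
    realOp_apply_inv_self G x⟩

lemma one_le_norm_of_mem_integerPoints {x : Fin n → ℝ} (hx : x ∈ integerPoints n) (h0 : x ≠ 0) :
    1 ≤ ‖x‖ := by
  obtain ⟨z, hz⟩ := hx
  obtain ⟨i, hi⟩ := Function.ne_iff.1 h0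
  have hzi : z i ≠ 0 := by
    intro h
    exact hi (by simp [hz, h])
  refine le_trans ?_ (norm_le_pi_norm x i)
  rw [hz, Real.norm_eq_abs]
  exact_mod_cast Int.one_le_abs hzi

/-- The sum of the coordinates with respect to the generators of a simplicial cone is bounded
below by a positive constant on the nonzero integer points of the cone, hence on their closed
convex hull. -/
lemma zero_notMem_closure_kleinPolyhedron {v : Fin n → (Fin n → ℝ)} (hv : LinearIndependent ℝ v) :
    (0 : Fin n → ℝ) ∉
      closure (kleinPolyhedron {x | ∃ t : Fin n → ℝ, (∀ i, 0 ≤ t i) ∧ x = ∑ i, t i • v i}) := by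
  let b := basisOfLinearIndependentOfCardEqFinrank' v hv (by simp)
  have hb : ∀ i, b i = v i := fun i => by simp [b]
  let φ : (Fin n → ℝ) →ₗ[ℝ] ℝ := ∑ i, b.coord i
  have hφ : ∀ t : Fin n → ℝ, φ (∑ i, t i • v i) = ∑ i, t i := by
    intro t
    have : ∑ i, t i • v i = ∑ i, t i • b i := by simp [hb]
    rw [this]
    simp [φ, Finsupp.single_apply]
  let B : ℝ := 1 + ∑ i, ‖v i‖
  have hB : 0 < B := by positivity
  have hvB : ∀ i, ‖v i‖ ≤ B := fun i => by
    have := Finset.single_le_sum (f := fun i => ‖v i‖) (fun i _ => norm_nonneg _)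
      (Finset.mem_univ i)
    simp only [B]; linarith
  have hsub : kleinPolyhedron {x | ∃ t : Fin n → ℝ, (∀ i, 0 ≤ t i) ∧ x = ∑ i, t i • v i} ⊆
      {x | B⁻¹ ≤ φ x} := by
    refine convexHull_min ?_ (convex_halfSpace_ge φ.isLinear _)
    rintro x ⟨⟨⟨t, ht, rfl⟩, hx⟩, h0⟩
    have h1 := one_le_norm_of_mem_integerPoints hx h0
    have h2 : ‖∑ i, t i • v i‖ ≤ (∑ i, t i) * B := by
      rw [Finset.sum_mul]
      refine norm_sum_le_of_le _ fun i _ => ?_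
      rw [norm_smul, Real.norm_of_nonneg (ht i)]
      exact mul_le_mul_of_nonneg_left (hvB i) (ht i)
    rw [Set.mem_ofPred_eq, hφ, inv_le_iff_one_le_mul₀ hB]
    exact h1.trans h2
  intro h0
  have hcl : IsClosed {x | B⁻¹ ≤ φ x} :=
    isClosed_le continuous_const φ.continuous_of_finiteDimensional
  have := closure_minimal hsub hcl h0
  rw [Set.mem_ofPred_eq, map_zero] at this
  exact absurd (inv_pos.2 hB) (not_lt.2 this)

lemma linearIndependent_of_lines {u v : Fin n → (Fin n → ℝ)} (hu : LinearIndependent ℝ u)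
    (hl : ∀ i, l i = Submodule.span ℝ {u i}) (hv : ∀ i, v i ∈ l i ∧ v i ≠ 0) :
    LinearIndependent ℝ v := by
  have : ∀ i, ∃ c : ℝˣ, v i = c • u i := by
    intro i
    have h := (hv i).1
    rw [hl, Submodule.mem_span_singleton] at h
    obtain ⟨c, hc⟩ := h
    have hc0 : c ≠ 0 := by
      rintro rfl
      exact (hv i).2 (by rw [← hc, zero_smul])
    exact ⟨Units.mk0 c hc0, hc.symm⟩
  choose c hc using this
  convert hu.units_smul c
  exact funext hc

lemma zero_notMem_sail {u : Fin n → (Fin n → ℝ)} (hu : LinearIndependent ℝ u)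
    (hl : ∀ i, l i = Submodule.span ℝ {u i}) {C : Set (Fin n → ℝ)} (hC : C ∈ cones l) :
    (0 : Fin n → ℝ) ∉ sail C := by
  obtain ⟨v, hv, rfl⟩ := hC
  exact fun h => zero_notMem_closure_kleinPolyhedron (linearIndependent_of_lines hu hl hv)
    (frontier_subset_closure h)

/-- A preconnected set meeting both `s` and its complement meets the frontier of `s`. -/
lemma inter_frontier_nonempty {X : Type*} [TopologicalSpace X] {t s : Set X}
    (ht : IsPreconnected t) (h1 : (t ∩ s).Nonempty) (h2 : (t ∩ sᶜ).Nonempty) :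
    (t ∩ frontier s).Nonempty := by
  by_contra h
  have hcov : ∀ x ∈ t, x ∈ interior s ∨ x ∈ (closure s)ᶜ := by
    intro x hx
    by_contra! hx'
    exact h ⟨x, hx, not_not.1 hx'.2, hx'.1⟩
  obtain ⟨a, hat, has⟩ := h1
  obtain ⟨b, hbt, hbs⟩ := h2
  have ha : a ∈ interior s := (hcov a hat).resolve_right fun h' => h' (subset_closure has)
  have hb : b ∈ (closure s)ᶜ := (hcov b hbt).resolve_left fun h' => hbs (interior_subset h')
  obtain ⟨x, -, hx1, hx2⟩ := ht _ _ isOpen_interior isClosed_closure.isOpen_compl hcov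
    ⟨a, hat, ha⟩ ⟨b, hbt, hb⟩
  exact hx2 (subset_closure (interior_subset hx1))

/-- A nonzero integer point `p` lies in the Klein polyhedron of some cone, the origin does not,
so the segment from `0` to `p` meets the corresponding sail. -/
lemma exists_smul_mem_sail {u : Fin n → (Fin n → ℝ)} (hu : LinearIndependent ℝ u)
    (hl : ∀ i, l i = Submodule.span ℝ {u i}) {p : Fin n → ℝ} (hp : p ∈ integerPoints n)
    (hp0 : p ≠ 0) : ∃ C ∈ cones l, ∃ s : ℝ, s • p ∈ sail C := by
  let b := basisOfLinearIndependentOfCardEqFinrank' u hu (by simp)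
  have hb : ∀ i, b i = u i := fun i => by simp [b]
  have hpb : p = ∑ i, b.repr p i • u i := by
    conv_lhs => rw [← b.sum_repr p]
    simp [hb]
  -- the generators are oriented according to the signs of the coordinates of `p`
  let v : Fin n → (Fin n → ℝ) := fun i => (if 0 ≤ b.repr p i then (1 : ℝ) else -1) • u i
  have hv : ∀ i, v i ∈ l i ∧ v i ≠ 0 := fun i => by
    refine ⟨?_, ?_⟩
    · rw [hl]
      exact Submodule.smul_mem _ _ (Submodule.mem_span_singleton_self _)
    · refine smul_ne_zero ?_ (hu.ne_zero i)
      split_ifs <;> norm_num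
  refine ⟨_, ⟨v, hv, rfl⟩, ?_⟩
  set C := {x | ∃ t : Fin n → ℝ, (∀ i, 0 ≤ t i) ∧ x = ∑ i, t i • v i}
  have hpC : p ∈ kleinPolyhedron C := by
    refine subset_convexHull _ _ ⟨⟨⟨fun i => |b.repr p i|, fun i => abs_nonneg _, ?_⟩, hp⟩, hp0⟩
    conv_lhs => rw [hpb]
    refine Finset.sum_congr rfl fun i _ => ?_
    simp only [v, smul_smul]
    congr 1
    split_ifs with h
    · rw [abs_of_nonneg h, mul_one]
    · rw [abs_of_neg (not_le.1 h)]; ring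
  have h0 : (0 : Fin n → ℝ) ∉ kleinPolyhedron C := fun h =>
    zero_notMem_closure_kleinPolyhedron (linearIndependent_of_lines hu hl hv) (subset_closure h)
  obtain ⟨x, hx, hxf⟩ := inter_frontier_nonempty (convex_segment (𝕜 := ℝ) 0 p).isPreconnected
    ⟨p, right_mem_segment ℝ 0 p, hpC⟩ ⟨0, left_mem_segment ℝ 0 p, h0⟩
  obtain ⟨a, c, -, -, -, rfl⟩ := hx
  refine ⟨c, ?_⟩
  simpa [sail] using hxf

end sails

/-! ### Eigenlines of hyperbolic operators -/

section eigenlines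

variable {n : ℕ} {l : Fin n → Submodule ℝ (Fin n → ℝ)}

/-- The eigenlines of a hyperbolic operator in coordinates: they are spanned by a basis `u` of
eigenvectors, and eigenvectors with a common eigenvalue span one and the same of these lines. -/
lemma IsAlgebraic.exists_eigenbasis (hl : IsAlgebraic l) :
    ∃ A : GL (Fin n) ℤ, IsHyperbolic A ∧ Function.Injective l ∧
      ∃ u : Fin n → (Fin n → ℝ), LinearIndependent ℝ u ∧ (∀ i, l i = Submodule.span ℝ {u i}) ∧
        (∀ i, ∃ μ : ℝ, realOp A (u i) = μ • u i) ∧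
        ∀ (x y : Fin n → ℝ) (c : ℝ), x ≠ 0 → y ≠ 0 → realOp A x = c • x → realOp A y = c • y →
          ∃ i, l i = Submodule.span ℝ {x} ∧ l i = Submodule.span ℝ {y} := by
  obtain ⟨A, hA, hinj, hμ⟩ := hl
  choose μ hμ hlμ using hμ
  have hμinj : Function.Injective μ := fun i j hij => hinj (by rw [hlμ, hlμ, hij])
  choose u hu using fun i => (hμ i).exists_hasEigenvector
  have hind := Module.End.eigenvectors_linearIndependent' (realOp A) μ hμinj u hu
  have hAu : ∀ i, realOp A (u i) = μ i • u i := fun i => (hu i).apply_eq_smul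
  -- every eigenvector is proportional to one of the `u i`
  have key : ∀ (x : Fin n → ℝ) (c : ℝ), x ≠ 0 → realOp A x = c • x →
      ∃ i, c = μ i ∧ ∃ t : ℝ, t ≠ 0 ∧ x = t • u i := by
    intro x c hx hc
    let b := basisOfLinearIndependentOfCardEqFinrank' u hind (by simp)
    have hb : ∀ i, b i = u i := fun i => by simp [b]
    have hxb : x = ∑ i, b.repr x i • u i := by
      conv_lhs => rw [← b.sum_repr x]
      simp [hb]
    have h0 : ∑ i, (b.repr x i * (μ i - c)) • u i = 0 := by
      have h1 : realOp A x = ∑ i, (b.repr x i * μ i) • u i := by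
        conv_lhs => rw [hxb]
        simp [map_sum, hAu, smul_smul]
      have h2 : c • x = ∑ i, (b.repr x i * c) • u i := by
        conv_lhs => rw [hxb]
        simp [Finset.smul_sum, smul_smul, mul_comm]
      simp only [mul_sub, sub_smul, Finset.sum_sub_distrib]
      rw [← h1, ← h2, hc, sub_self]
    have h3 := Fintype.linearIndependent_iff.1 hind _ h0
    have hex : ∃ i, b.repr x i ≠ 0 := by
      by_contra! hall
      exact hx (by rw [hxb]; simp [hall])
    obtain ⟨i, hi⟩ := hex
    have hci : c = μ i := by
      have := (mul_eq_zero.1 (h3 i)).resolve_left hi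
      linarith
    refine ⟨i, hci, b.repr x i, hi, ?_⟩
    conv_lhs => rw [hxb]
    refine Finset.sum_eq_single i (fun j _ hj => ?_) (by simp)
    have : b.repr x j = 0 := (mul_eq_zero.1 (h3 j)).resolve_right fun h => hj
      (hμinj (by rw [← hci]; linarith))
    rw [this, zero_smul]
  have hspan : ∀ i, l i = Submodule.span ℝ {u i} := by
    intro i
    rw [hlμ]
    refine le_antisymm (fun x hx => ?_) ?_
    · by_cases hx0 : x = 0
      · rw [hx0]; exact zero_mem _
      obtain ⟨j, hj, t, -, rfl⟩ := key x (μ i) hx0 (Module.End.mem_eigenspace_iff.1 hx)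
      rw [hμinj hj]
      exact Submodule.smul_mem _ _ (Submodule.mem_span_singleton_self _)
    · rw [Submodule.span_singleton_le_iff_mem]
      exact (hu i).1
  refine ⟨A, hA, hinj, u, hind, hspan, fun i => ⟨μ i, hAu i⟩, fun x y c hx hy hcx hcy => ?_⟩
  obtain ⟨i, hi, t, ht, rfl⟩ := key x c hx hcx
  obtain ⟨j, hj, t', ht', rfl⟩ := key y c hy hcy
  obtain rfl := hμinj (hi.symm.trans hj)
  exact ⟨i, by rw [hspan, Submodule.span_singleton_smul_eq ht.isUnit],
    by rw [hspan, Submodule.span_singleton_smul_eq ht'.isUnit]⟩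

end eigenlines

/-! ### The field generated by an eigenvector -/

section field

open Polynomial IntermediateField

variable {n : ℕ} {E : Type*} [Field E] [Algebra ℚ E]

/-- An eigenvalue of an integer matrix is a root of its characteristic polynomial. -/
lemma aeval_charpoly_eq_zero {A : Matrix (Fin n) (Fin n) ℤ} {v : Fin n → E} (hv : v ≠ 0)
    {c : E} (h : intMulVec A v = c • v) :
    aeval c (A.map (Int.castRingHom ℚ)).charpoly = 0 := by
  have h1 : (A.map (Int.castRingHom E)).charpoly.eval c = 0 := by
    rw [Matrix.eval_charpoly, ← Matrix.exists_mulVec_eq_zero_iff]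
    refine ⟨v, hv, ?_⟩
    rw [Matrix.sub_mulVec, ← intMulVec, h]
    simp [Matrix.scalar_apply, ← Matrix.smul_one_eq_diagonal, Matrix.smul_mulVec]
  have h2 : A.map (Int.castRingHom E) =
      (A.map (Int.castRingHom ℚ)).map (algebraMap ℚ E) := by
    ext i j; simp
  rw [h2, Matrix.charpoly_map, eval_map_algebraMap] at h1
  exact h1

/-- For an eigenvector `v`, one of whose coordinates is `1`, of an integer matrix with irreducible
characteristic polynomial, the coordinates form a basis of the field generated by the eigenvalue:
their `ℚ`-span contains `1` and is stable under multiplication by the eigenvalue. -/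
lemma eigenvector_coordinates {A : Matrix (Fin n) (Fin n) ℤ}
    (hA : Irreducible (A.map (Int.castRingHom ℚ)).charpoly) {v : Fin n → E} {i₀ : Fin n}
    (hv : v i₀ = 1) {c : E} (h : intMulVec A v = c • v) :
    LinearIndependent ℚ v ∧ Module.finrank ℚ ℚ⟮c⟯ = n ∧
      minpoly ℚ c = (A.map (Int.castRingHom ℚ)).charpoly ∧
      Submodule.span ℚ (Set.range v) = ℚ⟮c⟯.toSubalgebra.toSubmodule := by
  have hv0 : v ≠ 0 := fun h0 => by simp [h0] at hv
  have hroot := aeval_charpoly_eq_zero hv0 h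
  have hmin : minpoly ℚ c = (A.map (Int.castRingHom ℚ)).charpoly :=
    (minpoly.eq_of_irreducible_of_monic hA hroot (Matrix.charpoly_monic _)).symm
  have hint : IsIntegral ℚ c := ⟨_, Matrix.charpoly_monic _, hroot⟩
  have hrank : Module.finrank ℚ ℚ⟮c⟯ = n := by
    rw [adjoin.finrank hint, hmin, Matrix.charpoly_natDegree_eq_dim, Fintype.card_fin]
  set S := Submodule.span ℚ (Set.range v) with hS
  have hvS : ∀ i, v i ∈ S := fun i => Submodule.subset_span ⟨i, rfl⟩
  have hstab : ∀ x ∈ S, c * x ∈ S := by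
    intro x hx
    induction hx using Submodule.span_induction with
    | mem x hx =>
      obtain ⟨i, rfl⟩ := hx
      have := congrFun h i
      rw [intMulVec_apply, Pi.smul_apply, smul_eq_mul] at this
      rw [← this]
      refine Submodule.sum_mem _ fun j _ => ?_
      have := S.smul_mem (A i j : ℚ) (hvS j)
      rwa [Algebra.smul_def, map_intCast] at this
    | zero => simp
    | add x y _ _ hx hy => rw [mul_add]; exact S.add_mem hx hy
    | smul a x _ hx => rw [mul_smul_comm]; exact S.smul_mem _ hx
  have hle : ℚ⟮c⟯.toSubalgebra.toSubmodule ≤ S := by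
    intro y hy
    rw [Subalgebra.mem_toSubmodule, adjoin_simple_toSubalgebra_of_isAlgebraic
      hint.isAlgebraic] at hy
    have : ∀ x ∈ S, y * x ∈ S := by
      induction hy using Algebra.adjoin_induction with
      | mem z hz => rw [Set.mem_singleton_iff.1 hz]; exact hstab
      | algebraMap r => intro x hx; rw [← Algebra.smul_def]; exact S.smul_mem _ hx
      | add a b _ _ ha hb => intro x hx; rw [add_mul]; exact S.add_mem (ha x hx) (hb x hx)
      | mul a b _ _ ha hb => intro x hx; rw [mul_assoc]; exact ha _ (hb x hx)
    simpa [hv] using this _ (hvS i₀)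
  have hfS : Module.finrank ℚ S ≤ n := by
    simpa [Set.finrank] using finrank_range_le_card (R := ℚ) v
  have hfin : FiniteDimensional ℚ S := FiniteDimensional.span_of_finite ℚ (Set.finite_range v)
  have heq : ℚ⟮c⟯.toSubalgebra.toSubmodule = S :=
    Submodule.eq_of_le_of_finrank_le hle (hfS.trans hrank.ge)
  refine ⟨?_, hrank, hmin, heq.symm⟩
  rw [linearIndependent_iff_card_eq_finrank_span, Fintype.card_fin]
  change n = Module.finrank ℚ S
  rw [← heq]
  exact hrank.symm

/-- A simple extension has an endomorphism sending the generator to any given conjugate. -/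
lemma exists_algHom_apply_eq {F E : Type*} [Field F] [Field E] [Algebra F E] {c y : E}
    (hE : F⟮c⟯ = ⊤) (hc : IsIntegral F c)
    (hy : aeval y (minpoly F c) = 0) : ∃ σ : E →ₐ[F] E, σ c = y := by
  have hy' : aeval y (minpoly F (adjoin.powerBasis hc).gen) = 0 := by
    rwa [adjoin.powerBasis_gen, minpoly_gen]
  refine ⟨(((adjoin.powerBasis hc).lift y hy').comp (inclusion hE.ge)).comp
    (topEquiv (F := F) (E := E)).symm.toAlgHom, ?_⟩
  exact (adjoin.powerBasis hc).lift_gen y hy'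

end field

/-! ### Generators of discrete subgroups of a field with an automorphism -/

section discreteness

variable {E : Type*} [Field E] [CharZero E] {σ : E ≃ₐ[ℚ] E}

lemma exists_minimal_of_discrete {X : Type*} {T : Set X} (hT : T.Nonempty) {f : X → ℝ} {D : ℝ}
    (hD : 0 < D) (h : ∀ x ∈ T, ∃ N : ℕ, D * f x = N) : ∃ x ∈ T, ∀ y ∈ T, f x ≤ f y := by
  classical
  have hex : ∃ N : ℕ, ∃ x ∈ T, D * f x = N := by
    obtain ⟨x, hx⟩ := hT
    obtain ⟨N, hN⟩ := h x hx
    exact ⟨N, x, hx, hN⟩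
  obtain ⟨x, hx, hN⟩ := Nat.find_spec hex
  refine ⟨x, hx, fun y hy => ?_⟩
  obtain ⟨N', hN'⟩ := h y hy
  have h1 : Nat.find hex ≤ N' := Nat.find_min' hex ⟨y, hy, hN'⟩
  have h2 : D * f x ≤ D * f y := by rw [hN, hN']; exact_mod_cast h1
  exact le_of_mul_le_mul_left h2 hD

/-- An algebraic integer fixed by `σ` is a rational integer as soon as the fixed field of `σ`
is `ℚ`. -/
lemma exists_nat_of_isIntegral (hσ : ∀ x, σ x = x → ∃ r : ℚ, x = r)
    {ι : E →+* ℝ} {z : E} (hz : IsIntegral ℤ z)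
    (hfix : σ z = z) (h0 : 0 ≤ ι z) : ∃ N : ℕ, ι z = N := by
  obtain ⟨r, rfl⟩ := hσ z hfix
  have hr : IsIntegral ℤ (algebraMap ℚ E r) := by simpa using hz
  rw [isIntegral_algebraMap_iff (algebraMap ℚ E).injective, IsIntegrallyClosed.isIntegral_iff] at hr
  obtain ⟨m, rfl⟩ := hr
  simp only [algebraMap_int_eq, eq_intCast, Rat.cast_intCast, map_intCast] at h0 ⊢
  have hm : 0 ≤ m := by exact_mod_cast h0
  exact ⟨m.toNat, by exact_mod_cast (Int.toNat_of_nonneg hm).symm⟩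

/-- A discrete subgroup on which `σ` acts by a sign is cyclic: an element of minimal absolute
value generates it. -/
lemma exists_generator (hσ : ∀ x, σ x = x → ∃ r : ℚ, x = r) (ι : E →+* ℝ)
    {S : AddSubgroup E} {D : ℤ}
    (hD : D ≠ 0) (hint : ∀ x ∈ S, IsIntegral ℤ (D * x)) (hS : ∀ x ∈ S, σ (x * x) = x * x) :
    ∃ f ∈ S, ∀ y ∈ S, ∃ a : ℤ, y = a * f := by
  by_cases hne : ∃ x ∈ S, x ≠ 0
  swap
  · push Not at hne
    exact ⟨0, S.zero_mem, fun y hy => ⟨0, by simp [hne y hy]⟩⟩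
  have hD' : (0 : ℝ) < (D : ℝ) ^ 2 := by positivity
  obtain ⟨f, ⟨hfS, hf0⟩, hmin⟩ := exists_minimal_of_discrete (T := {x | x ∈ S ∧ x ≠ 0})
    (f := fun x => ι x ^ 2) hne hD' (by
      rintro x ⟨hx, -⟩
      have : (D : ℝ) ^ 2 * ι x ^ 2 = ι ((D * x) ^ 2) := by simp; ring
      rw [this]
      refine exists_nat_of_isIntegral hσ ((hint x hx).pow 2) ?_ ?_
      · have := hS x hx
        rw [map_mul] at this
        simp only [map_pow, map_mul, map_intCast]
        linear_combination (D : E) ^ 2 * this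
      · rw [map_pow]; positivity)
  refine ⟨f, hfS, fun y hy => ⟨round (ι y / ι f), ?_⟩⟩
  have hιf : ι f ≠ 0 := (map_ne_zero ι).2 hf0
  set a := round (ι y / ι f) with ha
  by_contra hne'
  have hmem : y - a * f ∈ S := by
    rw [← zsmul_eq_mul]; exact S.sub_mem hy (S.zsmul_mem hfS _)
  have h1 := hmin _ ⟨hmem, sub_ne_zero.2 hne'⟩
  have h2 : ι (y - a * f) = (ι y / ι f - a) * ι f := by
    simp only [map_sub, map_mul, map_intCast]; field_simp
  have h3 := abs_sub_round (ι y / ι f)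
  rw [← ha] at h3
  have h4 : (ι y / ι f - a) ^ 2 ≤ 1 / 4 := by
    rw [← sq_abs]; nlinarith [abs_nonneg (ι y / ι f - a)]
  have h5 : 0 < ι f ^ 2 := by positivity
  simp only [h2, mul_pow] at h1
  nlinarith

/-- A discrete subgroup on which `σ² = -1` is a cyclic `ℤ[i]`-module: the Euclidean algorithm in
`ℤ[i]`, carried out with the form `x² + σ(x)²`. -/
lemma exists_gaussian_generator (hσ : ∀ x, σ x = x → ∃ r : ℚ, x = r) (ι : E →+* ℝ)
    {S : AddSubgroup E} {D : ℤ}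
    (hD : D ≠ 0) (hint : ∀ x ∈ S, IsIntegral ℤ (D * x)) (hstab : ∀ x ∈ S, σ x ∈ S)
    (hS : ∀ x ∈ S, σ (σ x) = -x) :
    ∃ f ∈ S, ∀ y ∈ S, ∃ a b : ℤ, y = a * f + b * σ f := by
  by_cases hne : ∃ x ∈ S, x ≠ 0
  swap
  · push Not at hne
    exact ⟨0, S.zero_mem, fun y hy => ⟨0, 0, by simp [hne y hy]⟩⟩
  have hD' : (0 : ℝ) < (D : ℝ) ^ 2 := by positivity
  obtain ⟨f, ⟨hfS, hf0⟩, hmin⟩ := exists_minimal_of_discrete (T := {x | x ∈ S ∧ x ≠ 0})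
    (f := fun x => ι x ^ 2 + ι (σ x) ^ 2) hne hD' (by
      rintro x ⟨hx, -⟩
      have : (D : ℝ) ^ 2 * (ι x ^ 2 + ι (σ x) ^ 2) = ι ((D * x) ^ 2 + (D * σ x) ^ 2) := by
        simp; ring
      rw [this]
      refine exists_nat_of_isIntegral hσ
        (((hint x hx).pow 2).add ((hint _ (hstab x hx)).pow 2)) ?_ ?_
      · simp only [map_pow, map_mul, map_intCast, map_add, hS x hx]
        ring
      · rw [map_add, map_pow, map_pow]; positivity)
  have hιf : ι f ≠ 0 := (map_ne_zero ι).2 hf0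
  have hN : 0 < ι f ^ 2 + ι (σ f) ^ 2 := by positivity
  -- the coordinates of `y` with respect to `f` and `σ f`
  refine ⟨f, hfS, fun y hy => ⟨round ((ι y * ι f + ι (σ y) * ι (σ f)) / (ι f ^ 2 + ι (σ f) ^ 2)),
    round ((ι y * ι (σ f) - ι (σ y) * ι f) / (ι f ^ 2 + ι (σ f) ^ 2)), ?_⟩⟩
  set p := (ι y * ι f + ι (σ y) * ι (σ f)) / (ι f ^ 2 + ι (σ f) ^ 2) with hp
  set q := (ι y * ι (σ f) - ι (σ y) * ι f) / (ι f ^ 2 + ι (σ f) ^ 2) with hq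
  by_contra hne'
  have hmem : y - (round p * f + round q * σ f) ∈ S := by
    rw [← zsmul_eq_mul, ← zsmul_eq_mul]
    exact S.sub_mem hy (S.add_mem (S.zsmul_mem hfS _) (S.zsmul_mem (hstab f hfS) _))
  have h1 := hmin _ ⟨hmem, sub_ne_zero.2 hne'⟩
  have e1 : ι y = p * ι f + q * ι (σ f) := by rw [hp, hq]; field_simp; ring
  have e2 : ι (σ y) = p * ι (σ f) - q * ι f := by rw [hp, hq]; field_simp; ring
  have h2 : ι (y - (round p * f + round q * σ f)) ^ 2 +
      ι (σ (y - (round p * f + round q * σ f))) ^ 2 =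
      ((p - round p) ^ 2 + (q - round q) ^ 2) * (ι f ^ 2 + ι (σ f) ^ 2) := by
    simp only [map_sub, map_add, map_mul, map_intCast, hS f hfS, map_neg, e1, e2]
    ring
  have hpr : (p - round p) ^ 2 ≤ 1 / 4 := by
    rw [← sq_abs]; nlinarith [abs_nonneg (p - round p), abs_sub_round p]
  have hqr : (q - round q) ^ 2 ≤ 1 / 4 := by
    rw [← sq_abs]; nlinarith [abs_nonneg (q - round q), abs_sub_round q]
  simp only [h2] at h1
  nlinarith

end discreteness

/-! ### Lattices stable under an automorphism of order four -/

section lattice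

variable {E : Type*} [Field E] [CharZero E] {σ : E ≃ₐ[ℚ] E}

/-- A `σ`-stable lattice `M` containing `1`, where `σ⁴ = 1` and the fixed field of `σ` is `ℚ`, is
`d (ℤ + ℤ e + ℤ f + ℤ σ f)` with `e` and `f` generating the successive quotients of the filtration
of `d⁻¹ M` by the kernels of `σ - 1` and `σ² - 1`. -/
lemma exists_adapted_generators (hσ : ∀ x, σ x = x → ∃ r : ℚ, x = r)
    (hσ4 : ∀ x, σ (σ (σ (σ x))) = x) (ι : E →+* ℝ) {M : Submodule ℤ E} {D : ℤ} (hD : D ≠ 0)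
    (hint : ∀ x ∈ M, IsIntegral ℤ (D * x)) (hstab : ∀ x ∈ M, σ x ∈ M) (hone : (1 : E) ∈ M)
    (hM : ∃ x ∈ M, σ (σ x) ≠ x) :
    ∃ d e f : E, d ≠ 0 ∧ σ (σ f) ≠ f ∧
      (∃ s : ℤ, σ e = s - e) ∧ (∃ n k : ℤ, f + σ (σ f) = n + k * e) ∧
      ∀ x, x ∈ M ↔ d⁻¹ * x ∈ Submodule.span ℤ (Set.range ![1, e, f, σ f]) := by
  let s : E →+ E := (σ : E →+* E).toAddMonoidHom
  have hs : ∀ x, s x = σ x := fun x => rfl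
  let M₂ : AddSubgroup E := M.toAddSubgroup ⊓ (AddMonoidHom.id E - s.comp s).ker
  have hM₂ : ∀ x, x ∈ M₂ ↔ x ∈ M ∧ σ (σ x) = x := fun x =>
    ⟨fun h => ⟨h.1, (sub_eq_zero.1 h.2).symm⟩, fun h => ⟨h.1, sub_eq_zero.2 h.2.symm⟩⟩
  let M₁ : AddSubgroup E := M.toAddSubgroup ⊓ (AddMonoidHom.id E - s).ker
  have hM₁ : ∀ x, x ∈ M₁ ↔ x ∈ M ∧ σ x = x := fun x =>
    ⟨fun h => ⟨h.1, (sub_eq_zero.1 h.2).symm⟩, fun h => ⟨h.1, sub_eq_zero.2 h.2.symm⟩⟩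
  have hzM : ∀ (a : ℤ) {x : E}, x ∈ M → a * x ∈ M := fun a x hx => by
    rw [← zsmul_eq_mul]; exact M.smul_mem a hx
  obtain ⟨d, hd, hdgen⟩ := exists_generator hσ ι (S := M₁) hD
    (fun x hx => hint x ((hM₁ x).1 hx).1) (fun x hx => by rw [map_mul, ((hM₁ x).1 hx).2])
  obtain ⟨e', he', hegen⟩ := exists_generator hσ ι
    (S := M₂.map (AddMonoidHom.id E - s)) hD
    (by
      rintro _ ⟨x, hx, rfl⟩
      have hx := (hM₂ x).1 hx
      exact hint _ (M.sub_mem hx.1 (hstab x hx.1)))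
    (by
      rintro _ ⟨x, hx, rfl⟩
      have hx := (hM₂ x).1 hx
      simp [hs, hx.2]
      ring)
  obtain ⟨e, he, rfl⟩ := he'
  obtain ⟨f', hf', hfgen⟩ := exists_gaussian_generator hσ ι
    (S := M.toAddSubgroup.map (AddMonoidHom.id E - s.comp s)) hD
    (by
      rintro _ ⟨x, hx, rfl⟩
      exact hint _ (M.sub_mem hx (hstab _ (hstab x hx))))
    (by
      rintro _ ⟨x, hx, rfl⟩
      exact ⟨σ x, hstab x hx, by simp [hs]⟩)
    (by
      rintro _ ⟨x, hx, rfl⟩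
      simp [hs, hσ4])
  obtain ⟨f, hf, rfl⟩ := hf'
  replace hf : f ∈ M := hf
  rw [hM₁] at hd
  replace he := (hM₂ e).1 he
  replace hdgen : ∀ y ∈ M, σ y = y → ∃ a : ℤ, y = a * d := fun y hy hy' =>
    hdgen y ((hM₁ y).2 ⟨hy, hy'⟩)
  have hegen' : ∀ y ∈ M, σ (σ y) = y → ∃ a b : ℤ, y = a * d + b * e := by
    intro y hy hy'
    obtain ⟨b, hb⟩ := hegen (y - σ y) ⟨y, (hM₂ y).2 ⟨hy, hy'⟩, rfl⟩
    replace hb : y - σ y = b * (e - σ e) := hb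
    obtain ⟨a, ha⟩ := hdgen (y - b * e) (M.sub_mem hy (hzM b he.1)) (by
      simp only [map_sub, map_mul, map_intCast]
      linear_combination -hb)
    exact ⟨a, b, by rw [← ha]; ring⟩
  have hfgen' : ∀ y ∈ M, ∃ a b c m : ℤ, y = a * d + b * e + c * f + m * σ f := by
    intro y hy
    obtain ⟨c, m, hcm⟩ := hfgen (y - σ (σ y)) ⟨y, hy, rfl⟩
    replace hcm : y - σ (σ y) = c * (f - σ (σ f)) + m * σ (f - σ (σ f)) := hcm
    obtain ⟨a, b, hab⟩ := hegen' (y - (c * f + m * σ f))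
      (M.sub_mem hy (M.add_mem (hzM c hf) (hzM m (hstab f hf)))) (by
        simp only [map_sub, map_mul, map_intCast, map_add] at hcm ⊢
        linear_combination -hcm)
    exact ⟨a, b, c, m, by linear_combination hab⟩
  have hd0 : d ≠ 0 := by
    rintro rfl
    obtain ⟨a, ha⟩ := hdgen 1 hone (map_one σ)
    simp at ha
  have hσd : σ d = d := hd.2
  obtain ⟨t, ht⟩ := hdgen (e + σ e) (M.add_mem he.1 (hstab e he.1)) (by
    rw [map_add, he.2, add_comm])
  obtain ⟨n, k, hnk⟩ := hegen' (f + σ (σ f)) (M.add_mem hf (hstab _ (hstab f hf))) (by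
    rw [map_add, map_add, hσ4, add_comm])
  refine ⟨d, d⁻¹ * e, d⁻¹ * f, hd0, ?_, ⟨t, ?_⟩, ⟨n, k, ?_⟩, fun x => ?_⟩
  · intro h
    have hff : σ (σ f) = f := by
      simp only [map_mul, map_inv₀, hσd] at h
      exact mul_left_cancel₀ (inv_ne_zero hd0) h
    obtain ⟨x, hx, hne⟩ := hM
    obtain ⟨a, b, c, m, rfl⟩ := hfgen' x hx
    exact hne (by simp [hσd, he.2, hff])
  · simp only [map_mul, map_inv₀, hσd]
    field_simp
    linear_combination ht
  · simp only [map_mul, map_inv₀, hσd]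
    field_simp
    linear_combination hnk
  · rw [Submodule.mem_span_range_iff_exists_fun]
    constructor
    · intro hx
      obtain ⟨a, b, c, m, rfl⟩ := hfgen' x hx
      refine ⟨![a, b, c, m], ?_⟩
      simp only [Fin.sum_univ_four, Matrix.cons_val, zsmul_eq_mul, map_mul, map_inv₀, hσd]
      field_simp
    · rintro ⟨a, ha⟩
      have hx : x = a 0 * d + a 1 * e + a 2 * f + a 3 * σ f := by
        simp only [Fin.sum_univ_four, Matrix.cons_val, zsmul_eq_mul, map_mul, map_inv₀, hσd] at ha
        field_simp at ha
        linear_combination -ha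
      rw [hx]
      exact M.add_mem (M.add_mem (M.add_mem (hzM _ hd.1) (hzM _ he.1)) (hzM _ hf))
        (hzM _ (hstab f hf))

end lattice

/-! ### The normal forms -/

section normalForm

variable {E : Type*} [Field E] [CharZero E] {σ : E ≃ₐ[ℚ] E}

/-- Change of generators in the cyclic case: `σ²f + f` involves `e` with an odd coefficient. -/
lemma span_eq_of_odd {e f : E} {s n m : ℤ} (he : σ e = s - e)
    (hf : f + σ (σ f) = n + (2 * m + 1) * e) :
    ∃ ω : E, (σ (σ ω) = ω → σ (σ f) = f) ∧
      Submodule.span ℤ (Set.range ![1, e, f, σ f]) =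
        Submodule.span ℤ (Set.range ![1, ω, σ ω, σ (σ ω)]) ∧
      (σ ω + σ (σ (σ ω)) = -(ω + σ (σ ω)) ∨ σ ω + σ (σ (σ ω)) = 1 - (ω + σ (σ ω)) ∨
        σ ω + σ (σ (σ ω)) = 2 - (ω + σ (σ ω))) := by
  -- the sign and the shift normalize the trace modulo `4`
  obtain ⟨δ, j, hδ, hj⟩ : ∃ δ j : ℤ, δ * δ = 1 ∧
      (δ * (s + 2 * n) + 4 * j = 0 ∨ δ * (s + 2 * n) + 4 * j = 1 ∨
        δ * (s + 2 * n) + 4 * j = 2) := by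
    by_cases h : (s + 2 * n) % 4 = 3
    · exact ⟨-1, (s + 2 * n) / 4 + 1, by norm_num, by omega⟩
    · exact ⟨1, -((s + 2 * n) / 4), by norm_num, by omega⟩
  have hδ' : (δ : E) * δ = 1 := by exact_mod_cast hδ
  have hσσf : σ (σ f) = n + (2 * m + 1) * e - f := by linear_combination hf
  have hσσσf : σ (σ (σ f)) = n + (2 * m + 1) * (s - e) - σ f := by
    rw [hσσf]
    simp only [map_sub, map_add, map_mul, map_intCast, map_one, map_ofNat, he]
  have hσσe : σ (σ e) = e := by rw [he, map_sub, map_intCast, he]; ring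
  have hω1 : σ (δ * (f - m * e) + j) = δ * (σ f - m * (s - e)) + j := by
    simp only [map_sub, map_add, map_mul, map_intCast, he]
  have hω2 : σ (σ (δ * (f - m * e) + j)) = δ * (n + (m + 1) * e - f) + j := by
    rw [hω1]
    simp only [map_sub, map_add, map_mul, map_intCast, he, hσσf]
    ring
  have hω3 : σ (σ (σ (δ * (f - m * e) + j))) = δ * (n + (m + 1) * (s - e) - σ f) + j := by
    rw [hω2]
    simp only [map_sub, map_add, map_mul, map_intCast, map_one, he]
  refine ⟨δ * (f - m * e) + j, fun h => ?_, ?_, ?_⟩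
  · simp only [map_sub, map_add, map_mul, map_intCast, hσσe] at h
    linear_combination (δ : E) * h + (f - σ (σ f)) * hδ'
  · rw [hω2, hω1]
    apply le_antisymm <;> rw [Submodule.span_le, Set.range_subset_iff] <;> intro i <;>
      rw [SetLike.mem_coe, Submodule.mem_span_range_iff_exists_fun]
    · fin_cases i
      · exact ⟨![1, 0, 0, 0], by simp [Fin.sum_univ_four]⟩
      · refine ⟨![-2 * δ * j - n, δ, 0, δ], ?_⟩
        simp [Fin.sum_univ_four]
        linear_combination (e + n) * hδ'
      · refine ⟨![-δ * j + m * (-2 * δ * j - n), δ + m * δ, 0, m * δ], ?_⟩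
        simp [Fin.sum_univ_four]
        linear_combination (m * (e + n) + (f - m * e)) * hδ'
      · refine ⟨![-δ * j + m * s - m * (-2 * δ * j - n), -m * δ, δ, -m * δ], ?_⟩
        simp [Fin.sum_univ_four]
        linear_combination (-m * (e + n) + (σ f - m * (s - e))) * hδ'
    · fin_cases i
      · exact ⟨![1, 0, 0, 0], by simp [Fin.sum_univ_four]⟩
      · refine ⟨![j, -δ * m, δ, 0], ?_⟩
        simp [Fin.sum_univ_four]
        ring
      · refine ⟨![j - δ * m * s, δ * m, 0, δ], ?_⟩
        simp [Fin.sum_univ_four]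
        ring
      · refine ⟨![j + δ * n, δ * (m + 1), -δ, 0], ?_⟩
        simp [Fin.sum_univ_four]
        ring
  · rw [hω3, hω2, hω1]
    rcases hj with hj | hj | hj <;> have hj' := congrArg (Int.cast : ℤ → E) hj <;>
      push_cast at hj'
    · left; linear_combination hj'
    · right; left; linear_combination hj'
    · right; right; linear_combination hj'

/-- Change of generators in the split case: `σ²f + f` involves `e` with an even coefficient. -/
lemma span_eq_of_even {e f : E} {s n m : ℤ} (he : σ e = s - e) (hf : f + σ (σ f) = n + 2 * m * e) :
    ∃ ω : E, (σ (σ ω) = ω → σ (σ f) = f) ∧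
      (Submodule.span ℤ (Set.range ![1, e, f, σ f]) =
          Submodule.span ℤ (Set.range ![1, ω, σ ω, (ω + σ (σ ω)) / 2]) ∨
        Submodule.span ℤ (Set.range ![1, e, f, σ f]) =
          Submodule.span ℤ (Set.range ![1, ω, σ ω, (ω + σ (σ ω) + 1) / 2])) ∧
      (σ ω + σ (σ (σ ω)) = -(ω + σ (σ ω)) ∨ σ ω + σ (σ (σ ω)) = 2 - (ω + σ (σ ω))) := by
  obtain ⟨j, hj⟩ : ∃ j : ℤ, n + s + 2 * j = 0 ∨ n + s + 2 * j = 1 :=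
    ⟨-((n + s) / 2), by omega⟩
  have hσσf : σ (σ f) = n + 2 * m * e - f := by linear_combination hf
  have hσσe : σ (σ e) = e := by rw [he, map_sub, map_intCast, he]; ring
  have hω1 : σ (f - (m - 1) * e + j) = σ f - (m - 1) * (s - e) + j := by
    simp only [map_sub, map_add, map_mul, map_intCast, map_one, he]
  have hω2 : σ (σ (f - (m - 1) * e + j)) = n + (m + 1) * e - f + j := by
    rw [hω1]
    simp only [map_sub, map_add, map_mul, map_intCast, map_one, he, hσσf]
    ring
  have hω3 : σ (σ (σ (f - (m - 1) * e + j))) = n + (m + 1) * (s - e) - σ f + j := by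
    rw [hω2]
    simp only [map_sub, map_add, map_mul, map_intCast, map_one, he]
  have hspan : ∀ p : ℤ, Submodule.span ℤ (Set.range ![1, e, f, σ f]) =
      Submodule.span ℤ (Set.range ![1, f - (m - 1) * e + j, σ (f - (m - 1) * e + j),
        (p : E) + e + j]) := by
    intro p
    rw [hω1]
    apply le_antisymm <;> rw [Submodule.span_le, Set.range_subset_iff] <;> intro i <;>
      rw [SetLike.mem_coe, Submodule.mem_span_range_iff_exists_fun]
    · fin_cases i
      · exact ⟨![1, 0, 0, 0], by simp [Fin.sum_univ_four]⟩
      · refine ⟨![-p - j, 0, 0, 1], ?_⟩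
        simp [Fin.sum_univ_four]
      · refine ⟨![-j + (m - 1) * (-p - j), 1, 0, m - 1], ?_⟩
        simp [Fin.sum_univ_four]
        ring
      · refine ⟨![-j + (m - 1) * s - (m - 1) * (-p - j), 0, 1, -(m - 1)], ?_⟩
        simp [Fin.sum_univ_four]
        ring
    · fin_cases i
      · exact ⟨![1, 0, 0, 0], by simp [Fin.sum_univ_four]⟩
      · refine ⟨![j, -(m - 1), 1, 0], ?_⟩
        simp [Fin.sum_univ_four]
        ring
      · refine ⟨![j - (m - 1) * s, m - 1, 0, 1], ?_⟩
        simp [Fin.sum_univ_four]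
        ring
      · refine ⟨![p + j, 1, 0, 0], ?_⟩
        simp [Fin.sum_univ_four]
        ring
  refine ⟨f - (m - 1) * e + j, fun h => ?_, ?_, ?_⟩
  · simp only [map_sub, map_add, map_mul, map_intCast, map_one, hσσe] at h
    linear_combination h
  · obtain ⟨p, hp | hp⟩ := Int.even_or_odd' n
    · left
      rw [hspan p, hω2]
      have : (p : E) + e + j = (f - (m - 1) * e + j + (n + (m + 1) * e - f + j)) / 2 := by
        rw [hp]; push_cast; ring
      rw [this]
    · right
      rw [hspan (p + 1), hω2]
      have : ((p + 1 : ℤ) : E) + e + j =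
          (f - (m - 1) * e + j + (n + (m + 1) * e - f + j) + 1) / 2 := by
        rw [hp]; push_cast; ring
      rw [this]
  · rw [hω3, hω2, hω1]
    rcases hj with hj | hj <;> have hj' := congrArg (Int.cast : ℤ → E) hj <;>
      push_cast at hj'
    · left; linear_combination 2 * hj'
    · right; linear_combination 2 * hj'

end normalForm

/-! ### Change of basis -/

section equivalence

variable {n : ℕ} {E : Type*} [Field E]

lemma intCast_eq_zero_of_sum_eq_zero [CharZero E] {w : Fin n → E} (hw : LinearIndependent ℚ w)
    {a : Fin n → ℤ} (h : ∑ j, (a j : E) * w j = 0) : a = 0 := by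
  have h0 : ∑ j, (a j : ℚ) • w j = 0 := by
    rw [← h]
    refine Finset.sum_congr rfl fun j _ => ?_
    rw [Rat.smul_def, Rat.cast_intCast]
  ext j
  exact_mod_cast Fintype.linearIndependent_iff.1 hw _ h0 j

lemma intMulVec_injective [CharZero E] {w : Fin n → E} (hw : LinearIndependent ℚ w)
    {P Q : Matrix (Fin n) (Fin n) ℤ} (h : intMulVec P w = intMulVec Q w) : P = Q := by
  ext i j
  have := intCast_eq_zero_of_sum_eq_zero hw (a := fun j => P i j - Q i j) (by
    have := congrFun h i
    rw [intMulVec_apply, intMulVec_apply, ← sub_eq_zero, ← Finset.sum_sub_distrib] at this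
    simpa [sub_mul] using this)
  exact sub_eq_zero.1 (congrFun this j)

lemma linearIndependent_smul [CharZero E] {w : Fin n → E} (hw : LinearIndependent ℚ w) {c : E}
    (hc : c ≠ 0) : LinearIndependent ℚ (c • w) := by
  refine hw.map' (LinearMap.mulLeft ℚ c) ?_
  rw [LinearMap.ker_eq_bot]
  exact mul_right_injective₀ hc

/-- Two systems of generators of a lattice, the first one linearly independent, differ by a
matrix from `GL_n(ℤ)`. -/
lemma exists_intMulVec_eq_of_span_eq [CharZero E] {w u : Fin n → E}
    (hw : LinearIndependent ℚ w) {d : E}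
    (hd : d ≠ 0) (h : ∀ x, x ∈ Submodule.span ℤ (Set.range w) ↔
      d⁻¹ * x ∈ Submodule.span ℤ (Set.range u)) :
    ∃ X : GL (Fin n) ℤ, intMulVec (X : Matrix (Fin n) (Fin n) ℤ) w = d • u := by
  have hX : ∀ i, ∃ a : Fin n → ℤ, ∑ j, a j • w j = d * u i := fun i => by
    rw [← Submodule.mem_span_range_iff_exists_fun, h, inv_mul_cancel_left₀ hd]
    exact Submodule.subset_span ⟨i, rfl⟩
  have hY : ∀ i, ∃ a : Fin n → ℤ, ∑ j, a j • u j = d⁻¹ * w i := fun i => by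
    rw [← Submodule.mem_span_range_iff_exists_fun, ← h]
    exact Submodule.subset_span ⟨i, rfl⟩
  choose X hX using hX
  choose Y hY using hY
  have hXw : intMulVec (Matrix.of X) w = d • u := by
    ext i
    rw [intMulVec_apply]
    simpa using hX i
  have hYu : intMulVec (Matrix.of Y) (d • u) = w := by
    ext i
    rw [intMulVec_smul, Pi.smul_apply, intMulVec_apply, smul_eq_mul,
      ← mul_inv_cancel_left₀ hd (w i), ← hY i]
    simp
  have hYX : Matrix.of Y * Matrix.of X = 1 := intMulVec_injective hw (by
    rw [intMulVec_mul, hXw, hYu, intMulVec_one])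
  exact ⟨⟨Matrix.of X, Matrix.of Y, mul_eq_one_comm.1 hYX, hYX⟩, hXw⟩

lemma intMulVec_pow [CharZero E] {σ : E ≃ₐ[ℚ] E} {w : Fin n → E} {G : Matrix (Fin n) (Fin n) ℤ}
    (hG : ∀ i, σ (w i) = intMulVec G w i) (k : ℕ) (i : Fin n) :
    intMulVec (G ^ k) w i = (σ ^ k) (w i) := by
  induction k generalizing i with
  | zero => simp
  | succ k ih =>
    have hw : intMulVec G w = fun i => σ (w i) := funext fun i => (hG i).symm
    rw [pow_succ, intMulVec_mul, hw, pow_succ', AlgEquiv.mul_apply, ← ih]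
    exact (intMulVec_map (σ : E →+* E) (G ^ k) w i).symm

lemma equivalent_of_intMulVec_eq (ι : E →+* ℝ) {v u : Fin n → E} {X : GL (Fin n) ℤ} {c : E}
    (hc : c ≠ 0) (h : intMulVec (X : Matrix (Fin n) (Fin n) ℤ) v = c • u) :
    Equivalent (fun i => ι (v i)) (fun i => ι (u i)) := by
  refine ⟨X, ι c, (map_ne_zero ι).2 hc, ?_⟩
  rw [realOp_apply]
  ext i
  rw [← intMulVec_map, h]
  simp

lemma map_vec4 (ι : E →+* ℝ) (a b c d : E) :
    (fun i => ι (![a, b, c, d] i)) = ![ι a, ι b, ι c, ι d] := by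
  ext i; fin_cases i <;> rfl

end equivalence

/-! ### Classification of stable lattices -/

section classification

variable {E : Type*} [Field E] [CharZero E] {σ : E ≃ₐ[ℚ] E}

/-- The classification: if `σ` acts on the `ℚ`-basis `w` of `E` through an integer matrix and
the lattice spanned by `w` contains `1`, then this lattice is homothetic to one of the
seven normal forms. -/
lemma exists_sevenConditions [FiniteDimensional ℚ E] (hσ : ∀ x, σ x = x → ∃ r : ℚ, x = r)
    (hσ4 : ∀ x, σ (σ (σ (σ x))) = x) (hσ2 : ∃ x, σ (σ x) ≠ x) (ι : E →+* ℝ)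
    {v w : Fin 4 → E} (hw : LinearIndependent ℚ w) (hspan : Submodule.span ℚ (Set.range w) = ⊤)
    {G : Matrix (Fin 4) (Fin 4) ℤ} (hG : ∀ i, σ (w i) = intMulVec G w i)
    (hone : (1 : E) ∈ Submodule.span ℤ (Set.range w)) {c : E} (hc : c ≠ 0) (hvw : v = c • w) :
    ∃ ω : E, σ (σ ω) ≠ ω ∧
      SevenConditions (fun i => ι (v i)) (ι ω) (ι (σ ω)) (ι (σ (σ ω))) (ι (σ (σ (σ ω)))) := by
  set M := Submodule.span ℤ (Set.range w)
  have hwM : ∀ i, w i ∈ M := fun i => Submodule.subset_span ⟨i, rfl⟩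
  have halg : Algebra.IsAlgebraic ℤ E :=
    (IsFractionRing.comap_isAlgebraic_iff (A := ℤ) (K := ℚ)).2 inferInstance
  classical
  obtain ⟨D, hD, hint⟩ := Algebra.IsAlgebraic.exists_integral_multiples ℤ (Finset.univ.image w)
  have hint' : ∀ x ∈ M, IsIntegral ℤ ((D : E) * x) := by
    intro x hx
    induction hx using Submodule.span_induction with
    | mem x hx =>
      obtain ⟨i, rfl⟩ := hx
      simpa using hint (w i) (by simp)
    | zero => simpa using isIntegral_zero
    | add x y _ _ hx hy => rw [mul_add]; exact hx.add hy
    | smul a x _ hx => rw [mul_smul_comm]; exact hx.smul a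
  have hstab : ∀ x ∈ M, σ x ∈ M := by
    intro x hx
    induction hx using Submodule.span_induction with
    | mem x hx =>
      obtain ⟨i, rfl⟩ := hx
      rw [hG, intMulVec_apply]
      refine M.sum_mem fun j _ => ?_
      rw [← zsmul_eq_mul]
      exact M.smul_mem _ (hwM j)
    | zero => simp
    | add x y _ _ hx hy => rw [map_add]; exact M.add_mem hx hy
    | smul a x _ hx => rw [map_zsmul]; exact M.smul_mem a hx
  have hM : ∃ x ∈ M, σ (σ x) ≠ x := by
    by_contra! hall
    obtain ⟨x, hx'⟩ := hσ2
    apply hx'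
    clear hx'
    have hxs : x ∈ Submodule.span ℚ (Set.range w) := by rw [hspan]; trivial
    induction hxs using Submodule.span_induction with
    | mem x hx => obtain ⟨i, rfl⟩ := hx; exact hall _ (hwM i)
    | zero => simp
    | add x y _ _ hx hy => rw [map_add, map_add, hx, hy]
    | smul a x _ hx => rw [Rat.smul_def, map_mul, map_ratCast, map_mul, map_ratCast, hx]
  obtain ⟨d, e, f, hd, hff, ⟨s, hs⟩, ⟨n, k, hnk⟩, hMd⟩ :=
    exists_adapted_generators hσ hσ4 ι hD hint' hstab hone hM
  have hequiv : ∀ a b b' g : E,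
      Submodule.span ℤ (Set.range ![1, e, f, σ f]) = Submodule.span ℤ (Set.range ![a, b, b', g]) →
      Equivalent (fun i => ι (v i)) ![ι a, ι b, ι b', ι g] := by
    intro a b b' g hsp
    obtain ⟨X, hX⟩ := exists_intMulVec_eq_of_span_eq hw hd (u := ![a, b, b', g]) (by
      intro x; rw [← hsp]; exact hMd x)
    rw [← map_vec4]
    refine equivalent_of_intMulVec_eq ι (X := X) (c := c * d) (mul_ne_zero hc hd) ?_
    rw [hvw, intMulVec_smul, hX, smul_smul]
  obtain ⟨m, hm | hm⟩ := Int.even_or_odd' k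
  · obtain ⟨ω, hω, hsp, htr⟩ := span_eq_of_even (σ := σ) (e := e) (f := f) (s := s) (n := n)
      (m := m) hs (by rw [hnk, hm]; push_cast; ring)
    refine ⟨ω, fun h => hff (hω h), ?_⟩
    have htr' : ι (σ ω) + ι (σ (σ (σ ω))) = -(ι ω + ι (σ (σ ω))) ∨
        ι (σ ω) + ι (σ (σ (σ ω))) = 2 - (ι ω + ι (σ (σ ω))) := by
      refine htr.imp (fun h => ?_) fun h => ?_ <;> simpa [map_ofNat] using congrArg ι h
    rcases hsp with hsp | hsp <;> have heq := hequiv _ _ _ _ hsp <;>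
      simp only [map_one, map_div₀, map_add, map_ofNat] at heq <;> rcases htr' with h | h
    · exact .inr (.inr (.inr (.inl ⟨heq, h⟩)))
    · exact .inr (.inr (.inr (.inr (.inl ⟨heq, h⟩))))
    · exact .inr (.inr (.inr (.inr (.inr (.inl ⟨heq, h⟩)))))
    · exact .inr (.inr (.inr (.inr (.inr (.inr ⟨heq, h⟩)))))
  · obtain ⟨ω, hω, hsp, htr⟩ := span_eq_of_odd (σ := σ) (e := e) (f := f) (s := s) (n := n)
      (m := m) hs (by rw [hnk, hm]; push_cast; ring)
    refine ⟨ω, fun h => hff (hω h), ?_⟩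
    have htr' : ι (σ ω) + ι (σ (σ (σ ω))) = -(ι ω + ι (σ (σ ω))) ∨
        ι (σ ω) + ι (σ (σ (σ ω))) = 1 - (ι ω + ι (σ (σ ω))) ∨
        ι (σ ω) + ι (σ (σ (σ ω))) = 2 - (ι ω + ι (σ (σ ω))) := by
      refine htr.imp (fun h => ?_) (Or.imp (fun h => ?_) fun h => ?_) <;>
        simpa [map_ofNat] using congrArg ι h
    have heq := hequiv _ _ _ _ hsp
    simp only [map_one] at heq
    rcases htr' with h | h | h
    · exact .inl ⟨heq, h⟩
    · exact .inr (.inl ⟨heq, h⟩)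
    · exact .inr (.inr (.inl ⟨heq, h⟩))

end classification

/-! ### Cyclic quartic fields -/

section galois

open IntermediateField

variable {F E : Type*} [Field F] [Field E] [Algebra F E] [FiniteDimensional F E]

lemma exists_pow_eq_of_mem_zpowers {Γ : Type*} [Group Γ] [Finite Γ] {σ ρ : Γ}
    (h : ρ ∈ Subgroup.zpowers σ) : ∃ k < orderOf σ, σ ^ k = ρ := by
  classical
  simpa using mem_zpowers_iff_mem_range_orderOf.1 h

/-- In a cyclic quartic extension an element not fixed by the square of a generator is
primitive, because every nontrivial subgroup contains this square. -/
lemma natDegree_minpoly_eq_four [IsGalois F E] (h4 : Module.finrank F E = 4) {σ : E ≃ₐ[F] E}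
    (hσ : ∀ τ : E ≃ₐ[F] E, τ ∈ Subgroup.zpowers σ) (hord : orderOf σ = 4) {ω : E}
    (hω : σ (σ ω) ≠ ω) : (minpoly F ω).natDegree = 4 := by
  rw [← h4, ← Field.primitive_element_iff_minpoly_natDegree_eq]
  have hfix : F⟮ω⟯.fixingSubgroup = ⊥ := by
    rw [eq_bot_iff]
    intro τ hτ
    have hτω : τ ω = ω := (mem_fixingSubgroup_iff _ τ).1 hτ ω (mem_adjoin_simple_self F ω)
    obtain ⟨k, hk, rfl⟩ := exists_pow_eq_of_mem_zpowers (hσ τ)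
    rw [hord] at hk
    have hσ4 : σ (σ (σ (σ ω))) = ω := by
      have := pow_orderOf_eq_one σ
      rw [hord] at this
      simpa [pow_succ] using DFunLike.congr_fun this ω
    interval_cases k
    · simp
    · exact absurd (by simp at hτω; rw [hτω, hτω]) hω
    · exact absurd (by simpa [pow_succ] using hτω) hω
    · simp only [pow_succ, pow_zero, one_mul, AlgEquiv.mul_apply] at hτω
      rw [hτω] at hσ4
      exact absurd (by rw [hσ4, hσ4]) hω
  rw [← IsGalois.fixedField_fixingSubgroup F⟮ω⟯, hfix, fixedField_bot]

end galois

/-! ### Eigenframes over the generated field -/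

/-- An eigenvector `v` with entries in a field `E ⊆ ℝ` of an integer matrix whose characteristic
polynomial is irreducible, `E` being generated by the eigenvalue `c`, together with the real
eigenlines `l i`, the first of which is spanned by `v`. -/
structure IsEigenframe {E : Type*} [Field E] [CharZero E] (l : Fin 4 → Submodule ℝ (Fin 4 → ℝ))
    (ι : E →+* ℝ) (A : GL (Fin 4) ℤ) (v : Fin 4 → E) (c : E) : Prop where
  irreducible : Irreducible ((A : Matrix (Fin 4) (Fin 4) ℤ).map (Int.castRingHom ℚ)).charpoly
  apply_zero : v 0 = 1
  eigen : intMulVec (A : Matrix (Fin 4) (Fin 4) ℤ) v = c • v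
  adjoin_eq_top : IntermediateField.adjoin ℚ {c} = ⊤
  injective : Function.Injective l
  line_zero : l 0 = Submodule.span ℝ {fun i => ι (v i)}
  exists_basis : ∃ u : Fin 4 → (Fin 4 → ℝ), LinearIndependent ℝ u ∧
    ∀ i, l i = Submodule.span ℝ {u i}
  exists_eigenvalue : ∀ i, ∃ μ : ℝ, ∀ x ∈ l i, realOp A x = μ • x
  exists_line : ∀ (x y : Fin 4 → ℝ) (μ : ℝ), x ≠ 0 → y ≠ 0 → realOp A x = μ • x →
    realOp A y = μ • y → ∃ i, l i = Submodule.span ℝ {x} ∧ l i = Submodule.span ℝ {y}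

namespace IsEigenframe

variable {E : Type*} [Field E] [CharZero E] {l : Fin 4 → Submodule ℝ (Fin 4 → ℝ)}
  {ι : E →+* ℝ} {A : GL (Fin 4) ℤ} {v : Fin 4 → E} {c : E}

lemma linearIndependent (h : IsEigenframe l ι A v c) : LinearIndependent ℚ v :=
  (eigenvector_coordinates h.irreducible h.apply_zero h.eigen).1

lemma finrank_eq_four (h : IsEigenframe l ι A v c) : Module.finrank ℚ E = 4 := by
  have := (eigenvector_coordinates h.irreducible h.apply_zero h.eigen).2.1
  rw [h.adjoin_eq_top] at this
  rw [← this]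
  exact (IntermediateField.finrank_top').symm

lemma finiteDimensional (h : IsEigenframe l ι A v c) : FiniteDimensional ℚ E :=
  Module.finite_of_finrank_pos (by rw [h.finrank_eq_four]; norm_num)

lemma span_smul_eq_top (h : IsEigenframe l ι A v c) {a : E} (ha : a ≠ 0) :
    Submodule.span ℚ (Set.range (a • v)) = ⊤ :=
  have := h.finiteDimensional
  (linearIndependent_smul h.linearIndependent ha).span_eq_top_of_card_eq_finrank'
    (by rw [h.finrank_eq_four, Fintype.card_fin])

/-- Vectors over `E` normalized by an integer linear form that are eigenvectors with the same
eigenvalue coincide. -/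
lemma eq_of_eigen (h : IsEigenframe l ι A v c) {x y : Fin 4 → E} {μ : E} {q : Fin 4 → ℤ}
    (hx : intMulVec (A : Matrix (Fin 4) (Fin 4) ℤ) x = μ • x)
    (hy : intMulVec (A : Matrix (Fin 4) (Fin 4) ℤ) y = μ • y)
    (hqx : ∑ j, (q j : E) * x j = 1) (hqy : ∑ j, (q j : E) * y j = 1) : x = y := by
  have hne : ∀ z : Fin 4 → E, ∑ j, (q j : E) * z j = 1 → (fun i => ι (z i)) ≠ 0 := by
    intro z hz h0
    have hz0 : ∀ i, z i = 0 := fun i => (map_eq_zero ι).1 (congrFun h0 i)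
    simp [hz0] at hz
  have hreal : ∀ z : Fin 4 → E, intMulVec (A : Matrix (Fin 4) (Fin 4) ℤ) z = μ • z →
      realOp A (fun i => ι (z i)) = ι μ • fun i => ι (z i) := by
    intro z hz
    rw [realOp_apply]
    ext i
    rw [← intMulVec_map, hz]
    simp
  obtain ⟨i, h1, h2⟩ := h.exists_line _ _ (ι μ) (hne x hqx) (hne y hqy) (hreal x hx) (hreal y hy)
  have hmem : (fun i => ι (x i)) ∈ Submodule.span ℝ {fun i => ι (y i)} := by
    rw [← h2, h1]
    exact Submodule.mem_span_singleton_self _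
  obtain ⟨t, ht⟩ := Submodule.mem_span_singleton.1 hmem
  have hti : ∀ i, t * ι (y i) = ι (x i) := fun i => congrFun ht i
  have ht1 : t = 1 := by
    have e1 := congrArg ι hqx
    have e2 := congrArg ι hqy
    simp only [map_sum, map_mul, map_intCast, map_one] at e1 e2
    rw [← e1, ← mul_one t, ← e2, Finset.mul_sum]
    refine Finset.sum_congr rfl fun j _ => ?_
    rw [← hti]
    ring
  ext i
  apply ι.injective
  rw [← hti, ht1, one_mul]

lemma orderOf_eq_four (h : IsEigenframe l ι A v c) [IsGalois ℚ E] {σ : E ≃ₐ[ℚ] E}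
    (hσ : ∀ τ : E ≃ₐ[ℚ] E, τ ∈ Subgroup.zpowers σ) : orderOf σ = 4 := by
  have := h.finiteDimensional
  rw [orderOf_eq_card_of_forall_mem_zpowers hσ, IsGalois.card_aut_eq_finrank, h.finrank_eq_four]

/-- A cyclic symmetry with a nonzero fixed vector comes from a generator `σ` of the Galois group:
on the eigenvector normalized by an integer left eigenvector of `G` with eigenvalue `1` it acts as
`σ` acts on the entries. -/
lemma exists_galois_generator (h : IsEigenframe l ι A v c) {G : GL (Fin 4) ℤ}
    {τ : Equiv.Perm (Fin 4)} (hG : InducesPerm l G τ) (hτ : τ.IsCycle)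
    (hsupp : τ.support = Finset.univ) {x : Fin 4 → ℝ} (hx : x ≠ 0) (hGx : realOp G x = x) :
    IsGalois ℚ E ∧ ∃ σ : E ≃ₐ[ℚ] E, (∀ ρ : E ≃ₐ[ℚ] E, ρ ∈ Subgroup.zpowers σ) ∧
      ∃ (a : E) (q : Fin 4 → ℤ), a ≠ 0 ∧ ∑ j, (q j : E) * (a • v) j = 1 ∧
        ∀ i, σ ((a • v) i) = intMulVec (G : Matrix (Fin 4) (Fin 4) ℤ) (a • v) i := by
  have := h.finiteDimensional
  set g : Matrix (Fin 4) (Fin 4) ℤ := ↑G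
  obtain ⟨q, hq0, hq⟩ : ∃ q : Fin 4 → ℤ, q ≠ 0 ∧ q ᵥ* g = q := by
    have hdet : ((g - 1).map (Int.castRingHom ℝ)).det = 0 := by
      rw [← Matrix.exists_mulVec_eq_zero_iff]
      refine ⟨x, hx, ?_⟩
      rw [Matrix.map_sub _ (by simp), Matrix.sub_mulVec, ← intMulVec, ← intMulVec, intMulVec_one,
        ← realOp_apply, hGx, sub_self]
    have hdet' : (g - 1).det = 0 := by
      have h1 := RingHom.map_det (Int.castRingHom ℝ) (g - 1)
      rw [RingHom.mapMatrix_apply, hdet] at h1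
      exact (map_eq_zero_iff _ (RingHom.injective_int _)).1 h1
    obtain ⟨q, hq0, hq⟩ := Matrix.exists_vecMul_eq_zero_iff.2 hdet'
    refine ⟨q, hq0, ?_⟩
    rwa [Matrix.vecMul_sub, Matrix.vecMul_one, sub_eq_zero] at hq
  have hqG : ∀ z : Fin 4 → E, ∑ i, (q i : E) * intMulVec g z i = ∑ j, (q j : E) * z j := by
    intro z
    simp only [intMulVec_apply, Finset.mul_sum]
    rw [Finset.sum_comm]
    refine Finset.sum_congr rfl fun j _ => ?_
    conv_rhs => rw [← hq]
    simp [vecMul, dotProduct, Finset.sum_mul, mul_assoc]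
  set θ : E := ∑ j, (q j : E) * v j with hθ
  have hθ0 : θ ≠ 0 := fun h0 => hq0 (intCast_eq_zero_of_sum_eq_zero h.linearIndependent h0)
  set w : Fin 4 → E := θ⁻¹ • v with hw
  have hqw : ∑ j, (q j : E) * w j = 1 := by
    rw [← inv_mul_cancel₀ hθ0]
    conv_rhs => rw [hθ, Finset.mul_sum]
    refine Finset.sum_congr rfl fun j _ => ?_
    simp only [hw, Pi.smul_apply, smul_eq_mul]
    ring
  have hAw : intMulVec (A : Matrix (Fin 4) (Fin 4) ℤ) w = c • w := by
    rw [hw, intMulVec_smul, h.eigen, smul_comm]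
  have hwl : l 0 = Submodule.span ℝ {fun i => ι (w i)} := by
    have : (fun i => ι (w i)) = ι θ⁻¹ • fun i => ι (v i) := by ext i; simp [hw]
    rw [h.line_zero, this, Submodule.span_singleton_smul_eq]
    exact ((map_ne_zero ι).2 (inv_ne_zero hθ0)).isUnit
  have hmapl : ∀ z : Fin 4 → E, realOp G (fun i => ι (z i)) = fun i => ι (intMulVec g z i) := by
    intro z
    rw [realOp_apply]
    ext i
    rw [intMulVec_map]
  set w₁ : Fin 4 → E := intMulVec g w with hw₁
  have hqw₁ : ∑ j, (q j : E) * w₁ j = 1 := (hqG w).trans hqw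
  -- the eigenvalue of the image of `w` lies in `E`, since `q` is an integer form
  obtain ⟨μ, hμ⟩ : ∃ μ : E, intMulVec (A : Matrix (Fin 4) (Fin 4) ℤ) w₁ = μ • w₁ := by
    obtain ⟨μ, hμ⟩ := h.exists_eigenvalue (τ 0)
    have hmem : (fun i => ι (w₁ i)) ∈ l (τ 0) := by
      rw [← hG 0, hwl, ← hmapl]
      exact Submodule.mem_map_of_mem (Submodule.mem_span_singleton_self _)
    have h1 := hμ _ hmem
    rw [realOp_apply] at h1
    have h2 : ∀ i, ι (intMulVec (A : Matrix (Fin 4) (Fin 4) ℤ) w₁ i) = μ * ι (w₁ i) := by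
      intro i
      rw [intMulVec_map, h1]
      simp
    have h3 : ι (∑ j, (q j : E) * intMulVec (A : Matrix (Fin 4) (Fin 4) ℤ) w₁ j) = μ := by
      have e1 := congrArg ι hqw₁
      simp only [map_sum, map_mul, map_intCast, map_one] at e1 ⊢
      rw [← mul_one μ, ← e1, Finset.mul_sum]
      refine Finset.sum_congr rfl fun j _ => ?_
      rw [h2]
      ring
    refine ⟨∑ j, (q j : E) * intMulVec (A : Matrix (Fin 4) (Fin 4) ℤ) w₁ j,
      funext fun i => ι.injective ?_⟩
    rw [h2, Pi.smul_apply, smul_eq_mul, map_mul, h3]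
  obtain ⟨σ, hσ⟩ : ∃ σ : E ≃ₐ[ℚ] E, σ c = μ := by
    have hw₁0 : w₁ ≠ 0 := fun h0 => by simp [h0] at hqw₁
    have hv0 : v ≠ 0 := fun h0 => by simpa [h0] using h.apply_zero
    have hc := aeval_charpoly_eq_zero hv0 h.eigen
    obtain ⟨σ, hσ⟩ := exists_algHom_apply_eq h.adjoin_eq_top
      ⟨_, Matrix.charpoly_monic _, hc⟩ (y := μ) (by
        rw [(eigenvector_coordinates h.irreducible h.apply_zero h.eigen).2.2.1]
        exact aeval_charpoly_eq_zero hw₁0 hμ)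
    exact ⟨AlgEquiv.ofBijective σ σ.bijective, hσ⟩
  have hσw : ∀ i, σ (w i) = intMulVec g w i := by
    refine congrFun (h.eq_of_eigen (μ := μ) (q := q) ?_ hμ ?_ hqw₁)
    · ext i
      rw [← hσ]
      have := intMulVec_map (σ : E →+* E) (A : Matrix (Fin 4) (Fin 4) ℤ) w i
      rw [hAw] at this
      simpa using this.symm
    · have := congrArg σ hqw
      simpa using this
  have hlines : ∀ k : ℕ, l ((τ ^ k) 0) = Submodule.span ℝ {fun i => ι ((σ ^ k) (w i))} := by
    intro k
    induction k with
    | zero => simpa using hwl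
    | succ k ih =>
      rw [pow_succ', Equiv.Perm.mul_apply, ← hG, ih, Submodule.map_span, Set.image_singleton, hmapl]
      congr 2
      ext i
      congr 1
      rw [← intMulVec_pow hσw, ← funext (intMulVec_pow hσw k), ← intMulVec_mul, ← pow_succ']
  have hdvd : 4 ∣ orderOf σ := by
    have hτ4 : orderOf τ = 4 := by rw [hτ.orderOf, hsupp]; simp
    rw [← hτ4, orderOf_dvd_iff_pow_eq_one, hτ.pow_eq_one_iff' (x := 0)
      (Equiv.Perm.mem_support.1 (by rw [hsupp]; exact Finset.mem_univ _))]
    apply h.injective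
    rw [hlines, pow_orderOf_eq_one, hwl]
    simp
  have hcard_le : Nat.card (E ≃ₐ[ℚ] E) ≤ 4 := by
    rw [← h.finrank_eq_four, Nat.card_eq_fintype_card]
    exact AlgEquiv.card_le
  have hord_le : orderOf σ ≤ Nat.card (E ≃ₐ[ℚ] E) := orderOf_le_card
  have hpos : 0 < orderOf σ := orderOf_pos σ
  have hord4 : 4 ≤ orderOf σ := Nat.le_of_dvd hpos hdvd
  have hcard : Nat.card (E ≃ₐ[ℚ] E) = 4 := by omega
  have hgen : Subgroup.zpowers σ = ⊤ :=
    Subgroup.eq_top_of_card_eq _ (by rw [Nat.card_zpowers]; omega)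
  exact ⟨IsGalois.of_card_aut_eq_finrank ℚ E (by rw [hcard, h.finrank_eq_four]), σ,
    fun ρ => by rw [hgen]; trivial, θ⁻¹, q, inv_ne_zero hθ0, hqw, hσw⟩

/-- The lattice spanned by the normalized eigenvector is stable under `σ`, so the classification of
`σ`-stable lattices applies. -/
lemma exists_sevenConditions (h : IsEigenframe l ι A v c) {G : GL (Fin 4) ℤ}
    {τ : Equiv.Perm (Fin 4)} (hG : InducesPerm l G τ) (hτ : τ.IsCycle)
    (hsupp : τ.support = Finset.univ) {x : Fin 4 → ℝ} (hx : x ≠ 0) (hGx : realOp G x = x) :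
    IsGalois ℚ E ∧ ∃ σ : E ≃ₐ[ℚ] E, (∀ ρ : E ≃ₐ[ℚ] E, ρ ∈ Subgroup.zpowers σ) ∧
      ∃ ω : E, (minpoly ℚ ω).natDegree = 4 ∧
        SevenConditions (fun i => ι (v i)) (ι ω) (ι (σ ω)) (ι ((σ ^ 2) ω)) (ι ((σ ^ 2) (σ ω))) := by
  have := h.finiteDimensional
  obtain ⟨hgal, σ, hσ, a, q, ha, hq, hσv⟩ := h.exists_galois_generator hG hτ hsupp hx hGx
  have hord := h.orderOf_eq_four hσ
  have hfix : ∀ y, σ y = y → ∃ r : ℚ, y = r := by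
    intro y hy
    have hbot : y ∈ (⊥ : IntermediateField ℚ E) := by
      rw [IsGalois.mem_bot_iff_fixed]
      intro ρ
      obtain ⟨k, -, rfl⟩ := exists_pow_eq_of_mem_zpowers (hσ ρ)
      clear hσ hord hσv
      induction k with
      | zero => simp
      | succ k ih => rw [pow_succ, AlgEquiv.mul_apply, hy, ih]
    obtain ⟨r, rfl⟩ := IntermediateField.mem_bot.1 hbot
    exact ⟨r, by simp⟩
  have hσ4 : ∀ y, σ (σ (σ (σ y))) = y := by
    intro y
    have := pow_orderOf_eq_one σ
    rw [hord] at this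
    simpa [pow_succ] using DFunLike.congr_fun this y
  have hσ2 : ∃ y, σ (σ y) ≠ y := by
    by_contra! hall
    have h2 : σ ^ 2 = 1 := AlgEquiv.ext fun y => by simpa [pow_succ] using hall y
    have := orderOf_le_of_pow_eq_one (by norm_num) h2
    omega
  have hone : (1 : E) ∈ Submodule.span ℤ (Set.range (a • v)) := by
    rw [← hq]
    refine Submodule.sum_mem _ fun j _ => ?_
    rw [← zsmul_eq_mul]
    exact Submodule.smul_mem _ _ (Submodule.subset_span ⟨j, rfl⟩)
  obtain ⟨ω, hω, hseven⟩ := KleinCF.exists_sevenConditions hfix hσ4 hσ2 ι (v := v)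
    (linearIndependent_smul h.linearIndependent ha) (h.span_smul_eq_top ha) hσv hone
    (inv_ne_zero ha) (by rw [inv_smul_smul₀ ha])
  refine ⟨hgal, σ, hσ, ω, natDegree_minpoly_eq_four h.finrank_eq_four hσ hord hω, ?_⟩
  simpa [pow_succ] using hseven

end IsEigenframe

/-! ### Symmetries built from the Galois action -/

namespace IsEigenframe

variable {E : Type*} [Field E] [CharZero E] {l : Fin 4 → Submodule ℝ (Fin 4 → ℝ)}
  {ι : E →+* ℝ} {A : GL (Fin 4) ℤ} {v : Fin 4 → E} {c : E}

/-- If a generator of the Galois group acts on the entries of some multiple `y` of `v` through an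
integer matrix `P` and some integer form takes the value `1` on `y`, then `P` is a proper cyclic
symmetry: the form is a left eigenvector of `P` with eigenvalue `1`, so `P` also fixes a nonzero
integer vector. -/
lemma exists_properSymmetry_of_intMulVec (h : IsEigenframe l ι A v c) [IsGalois ℚ E]
    {σ : E ≃ₐ[ℚ] E} (hσ : ∀ ρ : E ≃ₐ[ℚ] E, ρ ∈ Subgroup.zpowers σ) {a : E} (ha : a ≠ 0)
    {y : Fin 4 → E} (hy : y = a • v) {q : Fin 4 → ℤ} (hq : ∑ j, (q j : E) * y j = 1)
    {P : Matrix (Fin 4) (Fin 4) ℤ} (hP : ∀ i, σ (y i) = intMulVec P y i) :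
    ∃ G : GL (Fin 4) ℤ, IsProperSymmetry l G ∧ IsCyclicSymmetry l G := by
  have := h.finiteDimensional
  have hord := h.orderOf_eq_four hσ
  have hyind : LinearIndependent ℚ y := hy ▸ linearIndependent_smul h.linearIndependent ha
  have hyspan : Submodule.span ℚ (Set.range y) = ⊤ := hy ▸ h.span_smul_eq_top ha
  have hAy : intMulVec (A : Matrix (Fin 4) (Fin 4) ℤ) y = c • y := by
    rw [hy, intMulVec_smul, h.eigen, smul_comm]
  have hP4 : P ^ 4 = 1 := intMulVec_injective hyind (by
    ext i
    have hσ4 := pow_orderOf_eq_one σ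
    rw [hord] at hσ4
    rw [intMulVec_pow hP, hσ4, intMulVec_one, AlgEquiv.one_apply])
  let G : GL (Fin 4) ℤ := ⟨P, P ^ 3, by rw [← pow_succ', hP4], by rw [← pow_succ, hP4]⟩
  have hG : ∀ z : Fin 4 → ℝ, realOp G z = intMulVec P z := realOp_apply G
  -- the conjugate vectors and the lines spanned by them
  let w : ℕ → Fin 4 → ℝ := fun k i => ι ((σ ^ k) (y i))
  have hqw : ∀ k, ∑ j, (q j : ℝ) * w k j = 1 := by
    intro k
    have := congrArg (fun z => ι ((σ ^ k) z)) hq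
    simpa only [map_sum, map_mul, map_intCast, map_one] using this
  have hw0 : ∀ k, w k ≠ 0 := by
    intro k h0
    have := hqw k
    simp [h0] at this
  have hAw : ∀ k, realOp A (w k) = ι ((σ ^ k) c) • w k := by
    intro k
    rw [realOp_apply]
    ext i
    have := intMulVec_map (ι.comp (σ ^ k : E ≃ₐ[ℚ] E).toRingEquiv.toRingHom)
      (A : Matrix (Fin 4) (Fin 4) ℤ) y i
    rw [hAy] at this
    refine Eq.trans this.symm ?_
    simp [w]
  have hPw : ∀ k, realOp G (w k) = w (k + 1) := by
    intro k
    rw [hG]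
    ext i
    change intMulVec P (fun i => ι ((σ ^ k) (y i))) i = ι ((σ ^ (k + 1)) (y i))
    rw [← intMulVec_map, ← funext (intMulVec_pow hP k), ← intMulVec_mul, ← pow_succ',
      intMulVec_pow hP]
  choose e he using fun k : Fin 4 => h.exists_line _ _ _ (hw0 k) (hw0 k) (hAw k) (hAw k)
  replace he : ∀ k : Fin 4, l (e k) = Submodule.span ℝ {w k} := fun k => (he k).1
  have heinj : Function.Injective e := by
    intro k k' hkk'
    have hmem : w k ∈ Submodule.span ℝ {w k'} := by
      rw [← he, ← hkk', he]
      exact Submodule.mem_span_singleton_self _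
    obtain ⟨t, ht⟩ := Submodule.mem_span_singleton.1 hmem
    have ht1 : t = 1 := by
      calc t = t * ∑ j, (q j : ℝ) * w k' j := by rw [hqw, mul_one]
        _ = ∑ j, (q j : ℝ) * (t • w k') j := by
          rw [Finset.mul_sum]
          exact Finset.sum_congr rfl fun j _ => mul_left_comm _ _ _
        _ = 1 := by rw [ht, hqw]
    have hσk : σ ^ (k : ℕ) = σ ^ (k' : ℕ) := by
      have hlin : (σ ^ (k : ℕ) : E ≃ₐ[ℚ] E).toLinearMap =
          (σ ^ (k' : ℕ) : E ≃ₐ[ℚ] E).toLinearMap := by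
        refine LinearMap.ext_on_range hyspan fun i => ι.injective ?_
        have := congrFun ht i
        rw [ht1, one_smul] at this
        exact this.symm
      exact AlgEquiv.ext fun z => LinearMap.congr_fun hlin z
    have := pow_injOn_Iio_orderOf (x := σ) (by simp [hord]) (by simp [hord]) hσk
    exact Fin.ext this
  let eₚ : Equiv.Perm (Fin 4) := Equiv.ofBijective e (Finite.injective_iff_bijective.1 heinj)
  let τ : Equiv.Perm (Fin 4) := eₚ * finRotate 4 * eₚ⁻¹
  have hτcyc : τ.IsCycle := isCycle_finRotate.conj
  have hτsupp : τ.support = Finset.univ := by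
    rw [Equiv.Perm.support_conj, support_finRotate]
    simp
  have hind : InducesPerm l G τ := by
    intro i
    obtain ⟨k, rfl⟩ := eₚ.surjective i
    have hτk : τ (eₚ k) = e (k + 1) := by
      simp [τ, eₚ]
    have hwk : w ((k + 1 : Fin 4) : ℕ) = w (k + 1) := by
      have : σ ^ ((k + 1 : Fin 4) : ℕ) = σ ^ ((k : ℕ) + 1) := by
        rw [← pow_mod_orderOf σ ((k : ℕ) + 1), hord]
        congr 1
      simp only [w, this]
    rw [hτk, he, hwk, ← hPw]
    change (l (e k)).map _ = _
    rw [he, Submodule.map_span, Set.image_singleton]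
  have hsymm : IsSymmetry l G := InducesPerm.isSymmetry hind
  refine ⟨G, ⟨⟨hsymm, fun h1 => ?_⟩, ?_⟩, hsymm, τ, hind, hτcyc, hτsupp⟩
  · refine hτcyc.ne_one (Equiv.ext fun i => h.injective ?_)
    rw [← hind i, h1 i]
  -- a nonzero integer vector fixed by `P`
  have hqP : q ᵥ* (P - 1) = 0 := by
    refine intCast_eq_zero_of_sum_eq_zero hyind ?_
    have h1 : ∑ i, (q i : E) * intMulVec P y i = 1 := by
      have := congrArg σ hq
      simp only [map_sum, map_mul, map_intCast, map_one, hP] at this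
      exact this
    have h2 : ∑ i, (q i : E) * intMulVec P y i = ∑ j, ((q ᵥ* P) j : E) * y j := by
      simp only [intMulVec_apply, Finset.mul_sum]
      rw [Finset.sum_comm]
      refine Finset.sum_congr rfl fun j _ => ?_
      simp [vecMul, dotProduct, Finset.sum_mul, mul_assoc]
    rw [h2] at h1
    rw [Matrix.vecMul_sub, Matrix.vecMul_one]
    simp only [Pi.sub_apply, Int.cast_sub, sub_mul, Finset.sum_sub_distrib]
    rw [h1, hq, sub_self]
  have hq0 : q ≠ 0 := by
    rintro rfl
    simp at hq
  obtain ⟨p, hp0, hp⟩ := Matrix.exists_mulVec_eq_zero_iff.2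
    (Matrix.exists_vecMul_eq_zero_iff.1 ⟨q, hq0, hqP⟩)
  rw [Matrix.sub_mulVec, Matrix.one_mulVec, sub_eq_zero] at hp
  let p' : Fin 4 → ℝ := fun i => (p i : ℝ)
  have hp'0 : p' ≠ 0 := by
    intro h0
    exact hp0 (funext fun i => Int.cast_eq_zero.1 (congrFun h0 i))
  have hGp : realOp G p' = p' := by
    rw [hG]
    ext i
    rw [intMulVec_apply]
    have := congrArg (Int.cast : ℤ → ℝ) (congrFun hp i)
    simpa [mulVec, dotProduct] using this
  obtain ⟨u, hu, hlu⟩ := h.exists_basis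
  obtain ⟨C, hC, s, hs⟩ := exists_smul_mem_sail hu hlu ⟨p, fun _ => rfl⟩ hp'0
  exact ⟨C, hC, _, hs, by rw [map_smul, hGp]⟩

/-- If a generator of the Galois group acts through an integer matrix on the entries of a vector
equivalent to `v`, then the symmetry is obtained by conjugating with the equivalence. -/
lemma exists_properSymmetry_of_equivalent (h : IsEigenframe l ι A v c) [IsGalois ℚ E]
    {σ : E ≃ₐ[ℚ] E} (hσ : ∀ ρ : E ≃ₐ[ℚ] E, ρ ∈ Subgroup.zpowers σ) {w : Fin 4 → E}
    (hw0 : w 0 = 1) (hvw : Equivalent (fun i => ι (v i)) (fun i => ι (w i)))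
    {H : Matrix (Fin 4) (Fin 4) ℤ} (hH : ∀ i, σ (w i) = intMulVec H w i) :
    ∃ G : GL (Fin 4) ℤ, IsProperSymmetry l G ∧ IsCyclicSymmetry l G := by
  obtain ⟨X, μ, hμ, hX⟩ := hvw
  rw [realOp_apply] at hX
  have hXι : ∀ i, ι (intMulVec (X : Matrix (Fin 4) (Fin 4) ℤ) v i) = μ * ι (w i) := fun i => by
    rw [intMulVec_map, hX]; simp
  -- the factor `μ` lies in `E`
  set m : E := intMulVec (X : Matrix (Fin 4) (Fin 4) ℤ) v 0 with hm
  have hιm : ι m = μ := by rw [hm, hXι, hw0, map_one, mul_one]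
  have hm0 : m ≠ 0 := by
    rw [← map_ne_zero ι, hιm]; exact hμ
  have hXv : intMulVec (X : Matrix (Fin 4) (Fin 4) ℤ) v = m • w := by
    ext i
    apply ι.injective
    rw [hXι, Pi.smul_apply, smul_eq_mul, map_mul, hιm]
  set y : Fin 4 → E := m⁻¹ • v with hy
  have hXy : intMulVec (X : Matrix (Fin 4) (Fin 4) ℤ) y = w := by
    rw [hy, intMulVec_smul, hXv, inv_smul_smul₀ hm0]
  have hyw : y = intMulVec (↑X⁻¹ : Matrix (Fin 4) (Fin 4) ℤ) w := by
    rw [← hXy, intMulVec_inv_apply_self]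
  refine h.exists_properSymmetry_of_intMulVec hσ (inv_ne_zero hm0) hy
    (q := (X : Matrix (Fin 4) (Fin 4) ℤ) 0)
    (P := (↑X⁻¹ : Matrix (Fin 4) (Fin 4) ℤ) * (H * (X : Matrix (Fin 4) (Fin 4) ℤ))) ?_ fun i => ?_
  · rw [← intMulVec_apply, hXy, hw0]
  · rw [intMulVec_mul, intMulVec_mul, hXy]
    conv_lhs => rw [hyw]
    refine (intMulVec_map (σ : E →+* E) _ w i).trans ?_
    congr 1
    exact funext hH

/-- The normal forms with `ℤ`-basis `1, ω, σ ω, σ² ω`; here `t` is the trace of `ω`. -/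
lemma exists_properSymmetry_of_cyclic (h : IsEigenframe l ι A v c) [IsGalois ℚ E]
    {σ : E ≃ₐ[ℚ] E} (hσ : ∀ ρ : E ≃ₐ[ℚ] E, ρ ∈ Subgroup.zpowers σ) {ω : E} (t : ℤ)
    (hv : Equivalent (fun i => ι (v i)) ![1, ι ω, ι (σ ω), ι (σ (σ ω))])
    (ht : ι (σ ω) + ι (σ (σ (σ ω))) = t - (ι ω + ι (σ (σ ω)))) :
    ∃ G : GL (Fin 4) ℤ, IsProperSymmetry l G ∧ IsCyclicSymmetry l G := by
  have ht' : σ ω + σ (σ (σ ω)) = t - (ω + σ (σ ω)) := ι.injective (by simpa using ht)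
  refine h.exists_properSymmetry_of_equivalent hσ (w := ![1, ω, σ ω, σ (σ ω)]) rfl
    (by rw [map_vec4, map_one]; exact hv)
    (H := !![1, 0, 0, 0; 0, 0, 1, 0; 0, 0, 0, 1; t, -1, -1, -1]) fun i => ?_
  rw [intMulVec_apply]
  fin_cases i <;> simp [Fin.sum_univ_four]
  linear_combination ht'

/-- The normal forms with `ℤ`-basis `1, ω, σ ω, (ω + σ² ω + ε) / 2`; here `2 r` is the trace
of `ω`. -/
lemma exists_properSymmetry_of_split (h : IsEigenframe l ι A v c) [IsGalois ℚ E]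
    {σ : E ≃ₐ[ℚ] E} (hσ : ∀ ρ : E ≃ₐ[ℚ] E, ρ ∈ Subgroup.zpowers σ) {ω : E} (r ε : ℤ)
    (hv : Equivalent (fun i => ι (v i)) ![1, ι ω, ι (σ ω), (ι ω + ι (σ (σ ω)) + ε) / 2])
    (ht : ι (σ ω) + ι (σ (σ (σ ω))) = 2 * r - (ι ω + ι (σ (σ ω)))) :
    ∃ G : GL (Fin 4) ℤ, IsProperSymmetry l G ∧ IsCyclicSymmetry l G := by
  have ht' : σ ω + σ (σ (σ ω)) = 2 * r - (ω + σ (σ ω)) :=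
    ι.injective (by simpa [map_ofNat] using ht)
  refine h.exists_properSymmetry_of_equivalent hσ
    (w := ![1, ω, σ ω, (ω + σ (σ ω) + ε) / 2]) rfl
    (by rw [map_vec4]; simpa [map_ofNat] using hv)
    (H := !![1, 0, 0, 0; 0, 0, 1, 0; -ε, -1, 0, 2; r + ε, 0, 0, -1]) fun i => ?_
  rw [intMulVec_apply]
  fin_cases i <;> simp [Fin.sum_univ_four, map_ofNat]
  · ring
  · linear_combination ht' / 2

lemma exists_properSymmetry (h : IsEigenframe l ι A v c) [IsGalois ℚ E]
    {σ : E ≃ₐ[ℚ] E} (hσ : ∀ ρ : E ≃ₐ[ℚ] E, ρ ∈ Subgroup.zpowers σ) {ω : E}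
    (hω : SevenConditions (fun i => ι (v i)) (ι ω) (ι (σ ω)) (ι (σ (σ ω))) (ι (σ (σ (σ ω))))) :
    ∃ G : GL (Fin 4) ℤ, IsProperSymmetry l G ∧ IsCyclicSymmetry l G := by
  rcases hω with ⟨hv, ht⟩ | ⟨hv, ht⟩ | ⟨hv, ht⟩ | ⟨hv, ht⟩ | ⟨hv, ht⟩ | ⟨hv, ht⟩ | ⟨hv, ht⟩
  · exact h.exists_properSymmetry_of_cyclic hσ 0 hv (by simpa using ht)
  · exact h.exists_properSymmetry_of_cyclic hσ 1 hv (by simpa using ht)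
  · exact h.exists_properSymmetry_of_cyclic hσ 2 hv (by simpa using ht)
  · exact h.exists_properSymmetry_of_split hσ 0 0 (by simpa using hv) (by simpa using ht)
  · exact h.exists_properSymmetry_of_split hσ 1 0 (by simpa using hv) (by simpa using ht)
  · exact h.exists_properSymmetry_of_split hσ 0 1 (by simpa using hv) (by simpa using ht)
  · exact h.exists_properSymmetry_of_split hσ 1 1 (by simpa using hv) (by simpa using ht)

end IsEigenframe

/-! ### The eigenframe of an algebraic continued fraction -/

/-- The eigenframe of an algebraic continued fraction over the field generated by the coordinates
of its first direction. -/
lemma IsAlgebraic.exists_isEigenframe {l : Fin 4 → Submodule ℝ (Fin 4 → ℝ)} (hl : IsAlgebraic l)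
    {α β γ : ℝ} (h1 : l 0 = Submodule.span ℝ {![1, α, β, γ]})
    {K : IntermediateField ℚ ℝ} (hK : K = IntermediateField.adjoin ℚ {α, β, γ}) :
    ∃ (A : GL (Fin 4) ℤ) (v : Fin 4 → K) (c : K),
      IsEigenframe l (algebraMap K ℝ) A v c ∧ (fun i => (v i : ℝ)) = ![1, α, β, γ] := by
  obtain ⟨A, hA, hinj, u, hind, hspan, heig, hline⟩ := hl.exists_eigenbasis
  have heig' : ∀ i, ∃ μ : ℝ, ∀ x ∈ l i, realOp A x = μ • x := by
    intro i
    obtain ⟨μ, hμ⟩ := heig i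
    refine ⟨μ, fun x hx => ?_⟩
    rw [hspan] at hx
    obtain ⟨t, rfl⟩ := Submodule.mem_span_singleton.1 hx
    rw [map_smul, hμ, smul_comm]
  have hmem : ∀ x ∈ ({α, β, γ} : Set ℝ), x ∈ K := fun x hx => by
    rw [hK]; exact IntermediateField.subset_adjoin ℚ _ hx
  let v : Fin 4 → K := ![1, ⟨α, hmem α (by simp)⟩, ⟨β, hmem β (by simp)⟩, ⟨γ, hmem γ (by simp)⟩]
  have hv : (fun i => (v i : ℝ)) = ![1, α, β, γ] := by
    ext i; fin_cases i <;> rfl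
  obtain ⟨μ, hμ⟩ := heig' 0
  have hAv : intMulVec (A : Matrix (Fin 4) (Fin 4) ℤ) ![1, α, β, γ] = μ • ![1, α, β, γ] := by
    rw [← realOp_apply]
    exact hμ _ (by rw [h1]; exact Submodule.mem_span_singleton_self _)
  let c : K := intMulVec (A : Matrix (Fin 4) (Fin 4) ℤ) v 0
  have hmap : ∀ i, ((intMulVec (A : Matrix (Fin 4) (Fin 4) ℤ) v i : K) : ℝ) =
      μ * ![1, α, β, γ] i := by
    intro i
    refine (intMulVec_map (algebraMap K ℝ) _ v i).trans ?_
    change intMulVec _ (fun i => (v i : ℝ)) i = _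
    rw [hv, hAv]
    rfl
  have hc : (c : ℝ) = μ := by simpa using hmap 0
  have hvc : intMulVec (A : Matrix (Fin 4) (Fin 4) ℤ) v = c • v := by
    ext i
    rw [hmap, ← hv, ← hc]
    rfl
  refine ⟨A, v, c, ⟨hA.1, rfl, hvc, ?_, hinj, ?_, ⟨u, hind, hspan⟩, heig', hline⟩, hv⟩
  · obtain ⟨-, hrank, -, hspanR⟩ := eigenvector_coordinates hA.1
      (v := ![1, α, β, γ]) (i₀ := 0) rfl hAv
    have hKle : K ≤ IntermediateField.adjoin ℚ {μ} := by
      rw [hK, IntermediateField.adjoin_le_iff]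
      have : ∀ i, ![1, α, β, γ] i ∈ IntermediateField.adjoin ℚ {μ} := by
        intro i
        have : ![1, α, β, γ] i ∈ Submodule.span ℚ (Set.range ![1, α, β, γ]) :=
          Submodule.subset_span ⟨i, rfl⟩
        rwa [hspanR] at this
      rintro x (rfl | rfl | rfl)
      exacts [this 1, this 2, this 3]
    have hKμ : K = IntermediateField.adjoin ℚ {μ} := by
      refine le_antisymm hKle ?_
      rw [IntermediateField.adjoin_simple_le_iff, ← hc]
      exact c.2
    have hfin : Module.finrank ℚ K = 4 := by rw [hKμ]; exact hrank
    obtain ⟨hvind, -, -, hspanK⟩ := eigenvector_coordinates hA.1 (v := v) (i₀ := 0) rfl hvc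
    have hfd : FiniteDimensional ℚ K :=
      Module.finite_of_finrank_pos (by rw [hfin]; norm_num)
    have htop := hvind.span_eq_top_of_card_eq_finrank' (by
      rw [Fintype.card_fin]; convert hfin.symm)
    rw [htop] at hspanK
    rw [eq_top_iff]
    intro x _
    have : x ∈ (⊤ : Submodule ℚ K) := trivial
    rwa [hspanK] at this
  · rw [h1, ← hv]; rfl

end KleinCF

/-- With `K = ℚ(α, β, γ)` and `σ` a generator of the Galois group, the embeddings are
`σ₂ = σ`, `σ₃ = σ²`, `σ₄ = σ³`, so `ψ = σ ω`, `ω' = σ² ω` and `ψ' = σ² ψ`. -/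
theorem theorem4 (l : Fin 4 → Submodule ℝ (Fin 4 → ℝ)) (hl : KleinCF.IsAlgebraic l)
    (α β γ : ℝ) (h1 : l 0 = Submodule.span ℝ {![1, α, β, γ]})
    (K : IntermediateField ℚ ℝ) (hK : K = IntermediateField.adjoin ℚ {α, β, γ}) :
    (∃ G : GL (Fin 4) ℤ, KleinCF.IsProperSymmetry l G ∧ KleinCF.IsCyclicSymmetry l G) ↔
      IsGalois ℚ K ∧ Module.finrank ℚ K = 4 ∧
        ∃ σ : K ≃ₐ[ℚ] K, (∀ τ : K ≃ₐ[ℚ] K, τ ∈ Subgroup.zpowers σ) ∧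
          ∃ ω : K, (minpoly ℚ ω).natDegree = 4 ∧
            ∃ ψ : K, ψ = σ ω ∧
              KleinCF.SevenConditions ![1, α, β, γ] (ω : ℝ) (ψ : ℝ)
                ((σ ^ 2) ω : K) ((σ ^ 2) ψ : K) := by
  obtain ⟨A, v, c, h, hv⟩ := hl.exists_isEigenframe h1 hK
  constructor
  · rintro ⟨G, ⟨-, C, hC, x, hx, hGx⟩, -, τ, hτ, hcyc, hsupp⟩
    obtain ⟨u, hu, hlu⟩ := h.exists_basis
    have hx0 : x ≠ 0 := by
      rintro rfl
      exact KleinCF.zero_notMem_sail hu hlu hC hx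
    obtain ⟨hgal, σ, hσ, ω, hω, hseven⟩ := h.exists_sevenConditions hτ hcyc hsupp hx0 hGx
    refine ⟨hgal, ?_, σ, hσ, ω, hω, σ ω, rfl, ?_⟩
    · convert h.finrank_eq_four
    · rw [← hv]; exact hseven
  · rintro ⟨hgal, -, σ, hσ, ω, -, ψ, rfl, hseven⟩
    refine h.exists_properSymmetry hσ (ω := ω) ?_
    rw [← hv] at hseven
    simpa [pow_succ] using hseven
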